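/- Let $M^2$ be a connected oriented smooth surface, let $\psi:M\to\mathbb{R}^3$ be a smooth immersion with induced metric $g=\psi^*\langle\cdot,\cdot\rangle$ and smooth unit normal field $\eta$, let $A$ be the shape operator given by $d\psi(AX)=-d\eta(X)$, let $f=\operatorname{trace}A$ be the mean curvature function, and let $K$ be the Gaussian curvature of $g$. Let $\tau=\operatorname{trace}\nabla d\psi$ be the tension field of $\psi$. Assume that $\psi$ is biconservative, that is, $\operatorname{div}S_2=0$ for the stress-energy tensor of the bienergy $$S_2(X,Y)=\Big(\tfrac12|\tau|^2+\langle d\psi,\nabla\tau\rangle\Big)\langle X,Y\rangle-\langle d\psi(X),\nabla_Y\tau\rangle-\langle d\psi(Y),\nabla_X\tau\rangle ,$$ where $\langle d\psi,\nabla\tau\rangle$ is the trace of $(X,Y)\mapsto\langle d\psi(X),\nabla_Y\tau\rangle$ with respect to $g$. Assume moreover that $f(p)>0$ and $(\nabla f)(p)\neq0$ at every point $p\in M$. Then $K<0$ on $M$, and $\left(M,(-K)^{1/2}g\right)$ is a Ricci surface: $\tilde g=(-K)^{1/2}g$ is a smooth Riemannian metric on $M$ whose Gaussian curvature $\tilde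 K$ satisfies $\tilde K<0$ everywhere, and the metric $(-\tilde K)^{1/2}\tilde g$ is flat, i.e. has Gaussian curvature $0$ everywhere. -/

import Mathlib

open scoped Manifold ContDiff

noncomputable section

namespace Biconservative

/-- The coordinate plane `ℝ²`. -/
abbrev Plane := EuclideanSpace ℝ (Fin 2)

/-- Euclidean three-space `ℝ³`. -/
abbrev Space := EuclideanSpace ℝ (Fin 3)

/-! ### Tensor calculus in coordinates

`G : Plane → Matrix (Fin 2) (Fin 2) ℝ` is the matrix `(g_{ij})` of a metric in local coordinates,
and `X : Plane → Space` the coordinate expression of a map into `ℝ³`. -/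

/-- The partial derivative `∂_i F` at `x`. -/
def pd {V : Type*} [NormedAddCommGroup V] [NormedSpace ℝ V]
    (i : Fin 2) (F : Plane → V) (x : Plane) : V :=
  fderiv ℝ F x (EuclideanSpace.single i 1)

/-- The Christoffel symbol `Γ^k_{ij}` of the Levi-Civita connection. -/
def christoffel (G : Plane → Matrix (Fin 2) (Fin 2) ℝ) (k i j : Fin 2) (x : Plane) : ℝ :=
  (1 / 2) * ∑ l, (G x)⁻¹ k l *
    (pd i (fun y => G y j l) x + pd j (fun y => G y i l) x - pd l (fun y => G y i j) x)

/-- The component `R^l_{ijk}` of the curvature tensor: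
`R(∂_i, ∂_j) ∂_k = ∑_l R^l_{ijk} ∂_l`, where `R(X,Y)Z = [∇_X, ∇_Y] Z - ∇_{[X,Y]} Z`. -/
def riemann (G : Plane → Matrix (Fin 2) (Fin 2) ℝ) (l i j k : Fin 2) (x : Plane) : ℝ :=
  pd i (christoffel G l j k) x - pd j (christoffel G l i k) x +
    ∑ m, (christoffel G l i m x * christoffel G m j k x
      - christoffel G l j m x * christoffel G m i k x)

/-- The Gaussian curvature `⟨R(∂_0, ∂_1) ∂_1, ∂_0⟩ / det (g_{ij})`. -/
def gaussCoord (G : Plane → Matrix (Fin 2) (Fin 2) ℝ) (x : Plane) : ℝ :=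
  (∑ l, G x l 0 * riemann G l 0 1 1 x) / (G x).det

/-- The tension field `τ = trace ∇dX` of a map into `ℝ³`:
`τ = ∑ g^{ij} (∂_i ∂_j X - ∑_k Γ^k_{ij} ∂_k X)`. -/
def tension (G : Plane → Matrix (Fin 2) (Fin 2) ℝ) (X : Plane → Space) (x : Plane) : Space :=
  ∑ i, ∑ j, (G x)⁻¹ i j • (pd i (pd j X) x - ∑ k, christoffel G k i j x • pd k X x)

/-- The stress-energy tensor of the bienergy,
`S₂(Y,Z) = (|τ|² / 2 + ⟨dX, ∇τ⟩) ⟨Y,Z⟩ - ⟨dX(Y), ∇_Z τ⟩ - ⟨dX(Z), ∇_Y τ⟩`,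
on `Y = ∂_i`, `Z = ∂_j`; the pulled back connection of `ℝ³` is componentwise differentiation. -/
def stressEnergy (G : Plane → Matrix (Fin 2) (Fin 2) ℝ) (X : Plane → Space) (i j : Fin 2)
    (x : Plane) : ℝ :=
  ((1 / 2) * ‖tension G X x‖ ^ 2
      + ∑ k, ∑ l, (G x)⁻¹ k l * inner ℝ (pd k X x) (pd l (tension G X) x)) * G x i j
    - inner ℝ (pd i X x) (pd j (tension G X) x)
    - inner ℝ (pd j X x) (pd i (tension G X) x)

/-- The divergence `(Div S)_j = ∑ g^{ik} (∇_i S)_{kj}` of a 2-covariant tensor `S`. -/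
def divTensor (G : Plane → Matrix (Fin 2) (Fin 2) ℝ) (S : Fin 2 → Fin 2 → Plane → ℝ)
    (j : Fin 2) (x : Plane) : ℝ :=
  ∑ i, ∑ k, (G x)⁻¹ i k *
    (pd i (S k j) x - ∑ m, christoffel G m i k x * S m j x
      - ∑ m, christoffel G m i j x * S k m x)

/-! ### Surfaces -/

section Surface

variable {M : Type*} [TopologicalSpace M] [ChartedSpace Plane M]

/-- A field of bilinear forms on the tangent planes of `M`. -/
abbrev FormField (M : Type*) [TopologicalSpace M] [ChartedSpace Plane M] :=
  ∀ p : M, TangentSpace (𝓡 2) p →L[ℝ] TangentSpace (𝓡 2) p →L[ℝ] ℝ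

/-- The field of forms `g` is a smooth Riemannian metric. -/
def IsRiemannianMetric [IsManifold (𝓡 2) ∞ M] (g : FormField M) : Prop :=
  ∃ G : Bundle.ContMDiffRiemannianMetric (𝓡 2) ∞ Plane (fun p : M => TangentSpace (𝓡 2) p),
    ∀ p, G.inner p = g p

/-- The matrix `g_{ij}` in the chart `e`, a function of the coordinates. -/
def metricInChart (g : FormField M) (e : OpenPartialHomeomorph M Plane) (x : Plane) :
    Matrix (Fin 2) (Fin 2) ℝ :=
  Matrix.of fun i j =>
    g (e.symm x) (mfderiv 𝓘(ℝ, Plane) (𝓡 2) e.symm x (EuclideanSpace.single i (1 : ℝ)))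
      (mfderiv 𝓘(ℝ, Plane) (𝓡 2) e.symm x (EuclideanSpace.single j (1 : ℝ)))

/-- The Gaussian curvature of `(M, g)` at `p`, computed in the preferred chart at `p`. -/
def gaussCurvature (g : FormField M) (p : M) : ℝ :=
  gaussCoord (metricInChart g (chartAt Plane p)) (chartAt Plane p p)

/-- `(M, g)` is a Ricci surface with constant `c`: `g` is a Riemannian metric, `c - K > 0`, and
the metric `(c - K)^{1/2} g` is flat. -/
def IsRicciSurface [IsManifold (𝓡 2) ∞ M] (c : ℝ) (g : FormField M) : Prop :=
  IsRiemannianMetric g ∧ (∀ p, 0 < c - gaussCurvature g p) ∧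
    ∀ p, gaussCurvature (fun q => ((c - gaussCurvature g q) ^ (1 / 2 : ℝ)) • g q) p = 0

/-- The differential of a map into `ℝ³`, with values in `ℝ³`. -/
def differential (ψ : M → Space) (p : M) : TangentSpace (𝓡 2) p →L[ℝ] Space :=
  mfderiv (𝓡 2) 𝓘(ℝ, Space) ψ p

/-- The map `ψ : M → ℝ³` is a smooth immersion. -/
def IsSmoothImmersion (ψ : M → Space) : Prop :=
  ContMDiff (𝓡 2) 𝓘(ℝ, Space) ∞ ψ ∧
    ∀ p, Function.Injective (differential ψ p)

/-- The metric induced by `ψ`: `g(v,w) = ⟨dψ(v), dψ(w)⟩`. -/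
def inducedMetric (ψ : M → Space) : FormField M := fun p =>
  let D : Plane →L[ℝ] Space := differential ψ p
  ((innerSL ℝ (E := Space) : Space →L[ℝ] Space →L[ℝ] ℝ).bilinearComp D D :
    Plane →L[ℝ] Plane →L[ℝ] ℝ)

theorem inducedMetric_apply (ψ : M → Space) (p : M) (v w : TangentSpace (𝓡 2) p) :
    inducedMetric ψ p v w = inner ℝ (differential ψ p v) (differential ψ p w) :=
  rfl

/-- `η` is a smooth unit normal vector field along `ψ`. -/
def IsUnitNormal (ψ η : M → Space) : Prop :=
  ContMDiff (𝓡 2) 𝓘(ℝ, Space) ∞ η ∧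
    ∀ p, ‖η p‖ = 1 ∧ ∀ v, inner ℝ (η p) (differential ψ p v) = 0

/-- The shape operator `A` with respect to the unit normal `η`. As `dη` is tangent to the surface,
`A = -(dψ)⁻¹ ∘ dη` is the operator with `dψ(A v) = -dη(v)`. -/
def shapeOperator (ψ η : M → Space) (p : M) :
    TangentSpace (𝓡 2) p →ₗ[ℝ] TangentSpace (𝓡 2) p :=
  -((differential ψ p).toLinearMap.leftInverse ∘ₗ (differential η p).toLinearMap)

/-- The mean curvature function `f = trace A`. -/
def meanCurvature (ψ η : M → Space) (p : M) : ℝ :=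
  LinearMap.trace ℝ (TangentSpace (𝓡 2) p) (shapeOperator ψ η p)

/-- `v` is the gradient of `f` at `p` with respect to `g`. -/
def IsGradientAt (g : FormField M) (f : M → ℝ) (p : M) (v : TangentSpace (𝓡 2) p) : Prop :=
  ∀ w : TangentSpace (𝓡 2) p, g p v w = mfderiv (𝓡 2) 𝓘(ℝ, ℝ) f p w

/-- The immersion `ψ` is biconservative: `Div S₂ = 0`, expressed in the charts of the atlas. -/
def IsBiconservative (ψ : M → Space) : Prop :=
  ∀ e ∈ atlas Plane M, ∀ x ∈ e.target, ∀ j,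
    divTensor (metricInChart (inducedMetric ψ) e)
      (stressEnergy (metricInChart (inducedMetric ψ) e) (fun y => ψ (e.symm y))) j x = 0

end Surface

end Biconservative

end

noncomputable section

namespace Biconservative

open Topology Filter

/-! ### Calculus of partial derivatives -/

section PartialDerivative

variable {V : Type*} [NormedAddCommGroup V] [NormedSpace ℝ V] {x : Plane} {i j : Fin 2}

/-! For a surface in `ℝ³` the tension field is `f η`, so `S₂ = -(f²/2) g + 2 f h` with `h` the
second fundamental form. By Codazzi `div h = df`, hence `div S₂ = f df + 2 h(∇f, ·)`, and
biconservativity says `A ∇f = -(f/2) ∇f` (`IsBiconservativePatch.eigen`). The other principal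
curvature is then `3f/2`, and the Gauss equation gives `K = -(3/4) f² < 0`.

Let `θ₁, θ₂` be the coframe dual to the unit principal frame `e₁ = ∇f/|∇f|`, `e₂`. Equality of mixed
partials for `X` and for `N`, after elimination of the connection form, yields `dθ₁ = 0` and `dθ₂ =
-(3/4) d(log f) ∧ θ₂`, while `df ∧ θ₁ = 0` (`coframe_equations`, `pd_mean_mul_gradForm`). Both
`f^{3/4} θᵢ` are therefore closed, so `f^{3/2} g` is flat (`gaussCoord_gram_flatCoframe`). No
coordinates are integrated: `gram_det_mul_gaussCoord` is an egregium for closed vector-valued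
1-forms, applied once to `dX` and once to this coframe.

The conformal formula `e^{2u} K(e^{2u} g) = K - Δu` turns this flatness into `Δ log f = (4/3) K`,
and then gives the curvature of every metric `c f^s g`: `c f^s K(c f^s g) = (s/2 - 3/4) f²`. Here
`(-K)^{1/2} g` is the case `s = 1`, with negative curvature proportional to `f`; the second
rescaling adds `1/2` to the exponent and lands on `s = 3/2`, where the right side vanishes. The
remaining lemmas carry these coordinate statements over to charts of `M`. -/

theorem pd_congr {F F' : Plane → V} (h : F =ᶠ[𝓝 x] F') : pd i F x = pd i F' x := by
  simp only [pd, h.fderiv_eq]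

theorem contDiffAt_pd {F : Plane → V} (h : ContDiffAt ℝ ∞ F x) : ContDiffAt ℝ ∞ (pd i F) x :=
  (h.fderiv_right (m := ∞) (by simp)).clm_apply contDiffAt_const

theorem differentiableAt_pd {F : Plane → V} (h : ContDiffAt ℝ ∞ F x) :
    DifferentiableAt ℝ (pd i F) x :=
  (contDiffAt_pd h).differentiableAt (by simp)

theorem pd_pd_comm {F : Plane → V} (h : ContDiffAt ℝ ∞ F x) :
    pd i (pd j F) x = pd j (pd i F) x := by
  have hd : DifferentiableAt ℝ (fderiv ℝ F) x :=
    (h.fderiv_right (m := ∞) (by simp)).differentiableAt (by simp)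
  have key (k l : Fin 2) : pd k (pd l F) x =
      fderiv ℝ (fderiv ℝ F) x (EuclideanSpace.single k 1) (EuclideanSpace.single l 1) := by
    have := (hd.hasFDerivAt.clm_apply
      (hasFDerivAt_const (EuclideanSpace.single l (1 : ℝ) : Plane) x)).fderiv
    change fderiv ℝ (fun y => fderiv ℝ F y (EuclideanSpace.single l 1)) x _ = _
    rw [this]
    simp
  rw [key, key]
  exact (h.isSymmSndFDerivAt (by simp; exact WithTop.coe_le_coe.2 le_top)) _ _

theorem pd_const (c : V) : pd i (fun _ => c) x = 0 := by simp [pd]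

theorem pd_add {F H : Plane → V} (hF : DifferentiableAt ℝ F x) (hH : DifferentiableAt ℝ H x) :
    pd i (fun y => F y + H y) x = pd i F x + pd i H x := by
  simp only [pd, fderiv_fun_add hF hH]; rfl

theorem pd_sub {F H : Plane → V} (hF : DifferentiableAt ℝ F x) (hH : DifferentiableAt ℝ H x) :
    pd i (fun y => F y - H y) x = pd i F x - pd i H x := by
  simp only [pd, fderiv_fun_sub hF hH]; rfl

theorem pd_smul {a : Plane → ℝ} {F : Plane → V} (ha : DifferentiableAt ℝ a x)
    (hF : DifferentiableAt ℝ F x) :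
    pd i (fun y => a y • F y) x = a x • pd i F x + pd i a x • F x := by
  simp only [pd, fderiv_fun_smul ha hF]; rfl

theorem pd_mul {a b : Plane → ℝ} (ha : DifferentiableAt ℝ a x) (hb : DifferentiableAt ℝ b x) :
    pd i (fun y => a y * b y) x = a x * pd i b x + pd i a x * b x :=
  pd_smul ha hb

theorem pd_const_mul {b : Plane → ℝ} (c : ℝ) (hb : DifferentiableAt ℝ b x) :
    pd i (fun y => c * b y) x = c * pd i b x := by
  rw [pd_mul (differentiableAt_const c) hb, pd_const]; ring

theorem pd_comp {a : Plane → ℝ} {r : ℝ → ℝ} {r' : ℝ} (hr : HasDerivAt r r' (a x))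
    (ha : DifferentiableAt ℝ a x) : pd i (fun y => r (a y)) x = r' * pd i a x := by
  have := (hr.comp_hasFDerivAt x ha.hasFDerivAt).fderiv
  simp only [pd]
  rw [show (fun y => r (a y)) = r ∘ a from rfl, this]
  simp

theorem pd_inner {V : Type*} [NormedAddCommGroup V] [InnerProductSpace ℝ V] {F H : Plane → V}
    (hF : DifferentiableAt ℝ F x) (hH : DifferentiableAt ℝ H x) :
    pd i (fun y => inner ℝ (F y) (H y)) x
      = inner ℝ (F x) (pd i H x) + inner ℝ (pd i F x) (H x) := by
  simp only [pd]
  rw [fderiv_inner_apply ℝ hF hH]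

end PartialDerivative

/-! ### The Gaussian curvature in coordinates -/

section Gauss

variable {G : Plane → Matrix (Fin 2) (Fin 2) ℝ} {x : Plane}

/-- No invertibility is required: for a singular matrix both sides are zero, as `0⁻¹ = 0`. -/
theorem matrix_inv_apply (A : Matrix (Fin 2) (Fin 2) ℝ) (i j : Fin 2) :
    A⁻¹ i j = (A 0 0 * A 1 1 - A 0 1 * A 1 0)⁻¹ * (!![A 1 1, -A 0 1; -A 1 0, A 0 0] i j) := by
  rw [Matrix.inv_def, Ring.inverse_eq_inv', Matrix.det_fin_two, Matrix.adjugate_fin_two]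
  rfl

theorem christoffel_congr {G' : Plane → Matrix (Fin 2) (Fin 2) ℝ} (h : G =ᶠ[𝓝 x] G')
    (k i j : Fin 2) : christoffel G k i j =ᶠ[𝓝 x] christoffel G' k i j := by
  filter_upwards [h.eventuallyEq_nhds] with y hy
  have e (a b c : Fin 2) : pd a (fun z => G z b c) y = pd a (fun z => G' z b c) y :=
    pd_congr (by filter_upwards [hy] with z hz; rw [hz])
  simp only [christoffel, e, hy.eq_of_nhds]

theorem gaussCoord_congr {G' : Plane → Matrix (Fin 2) (Fin 2) ℝ} (h : G =ᶠ[𝓝 x] G') :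
    gaussCoord G x = gaussCoord G' x := by
  have e (a k i j : Fin 2) : pd a (christoffel G k i j) x = pd a (christoffel G' k i j) x :=
    pd_congr (christoffel_congr h k i j)
  have e' (k i j : Fin 2) : christoffel G k i j x = christoffel G' k i j x :=
    (christoffel_congr h k i j).eq_of_nhds
  simp only [gaussCoord, riemann, e, e', h.eq_of_nhds]

/-- The Christoffel symbol of the first kind `Γ_{l,ij}`. -/
def christoffelFirst (G : Plane → Matrix (Fin 2) (Fin 2) ℝ) (l i j : Fin 2) (x : Plane) : ℝ :=
  (1 / 2) * (pd i (fun y => G y j l) x + pd j (fun y => G y i l) x - pd l (fun y => G y i j) x)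

theorem christoffel_eq (k i j : Fin 2) (x : Plane) :
    christoffel G k i j x = ∑ l, (G x)⁻¹ k l * christoffelFirst G l i j x := by
  simp only [christoffel, christoffelFirst, Finset.mul_sum]
  exact Finset.sum_congr rfl fun l _ => by ring

theorem sum_mul_christoffel (hdet : (G x).det ≠ 0) (l i j : Fin 2) :
    ∑ k, G x l k * christoffel G k i j x = christoffelFirst G l i j x := by
  have h1 : G x * (G x)⁻¹ = 1 := Matrix.mul_nonsing_inv _ (isUnit_iff_ne_zero.2 hdet)
  simp only [christoffel_eq, Finset.mul_sum]
  rw [Finset.sum_comm]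
  calc ∑ m, ∑ k, G x l k * ((G x)⁻¹ k m * christoffelFirst G m i j x)
      = ∑ m, (G x * (G x)⁻¹) l m * christoffelFirst G m i j x := by
        simp only [Matrix.mul_apply, Finset.sum_mul, mul_assoc]
    _ = _ := by rw [h1]; simp [Matrix.one_apply]

theorem contDiffAt_inv (hG : ∀ i j, ContDiffAt ℝ ∞ (fun y => G y i j) x)
    (hdet : (G x).det ≠ 0) (i j : Fin 2) : ContDiffAt ℝ ∞ (fun y => (G y)⁻¹ i j) x := by
  simp only [matrix_inv_apply]
  refine ContDiffAt.mul (ContDiffAt.inv (((hG 0 0).mul (hG 1 1)).sub ((hG 0 1).mul (hG 1 0))) ?_) ?_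
  · rwa [Matrix.det_fin_two] at hdet
  · fin_cases i <;> fin_cases j <;>
      simp only [Fin.zero_eta, Fin.mk_one, Matrix.of_apply, Matrix.cons_val', Matrix.cons_val_zero,
        Matrix.cons_val_one, Matrix.cons_val_fin_one] <;>
      first | exact hG _ _ | exact (hG _ _).neg

theorem contDiffAt_christoffelFirst (hG : ∀ i j, ContDiffAt ℝ ∞ (fun y => G y i j) x)
    (l i j : Fin 2) : ContDiffAt ℝ ∞ (christoffelFirst G l i j) x :=
  contDiffAt_const.mul
    (((contDiffAt_pd (hG _ _)).add (contDiffAt_pd (hG _ _))).sub (contDiffAt_pd (hG _ _)))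

theorem contDiffAt_christoffel (hG : ∀ i j, ContDiffAt ℝ ∞ (fun y => G y i j) x)
    (hdet : (G x).det ≠ 0) (k i j : Fin 2) : ContDiffAt ℝ ∞ (christoffel G k i j) x := by
  rw [show christoffel G k i j = fun y => ∑ l, (G y)⁻¹ k l * christoffelFirst G l i j y from
    funext (christoffel_eq k i j)]
  exact ContDiffAt.sum fun l _ => (contDiffAt_inv hG hdet k l).mul
    (contDiffAt_christoffelFirst hG l i j)

theorem eventually_det_ne_zero (hG : ∀ i j, ContDiffAt ℝ ∞ (fun y => G y i j) x)
    (hdet : (G x).det ≠ 0) : ∀ᶠ y in 𝓝 x, (G y).det ≠ 0 := by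
  have hc : ContinuousAt (fun y => (G y).det) x := by
    simp only [Matrix.det_fin_two]
    exact (((hG 0 0).mul (hG 1 1)).sub ((hG 0 1).mul (hG 1 0))).continuousAt
  exact hc.eventually_ne hdet

/-- Differentiating `∑ g_{lk} Γ^k_{ij} = Γ_{l,ij}`. -/
theorem sum_mul_pd_christoffel (hG : ∀ i j, ContDiffAt ℝ ∞ (fun y => G y i j) x)
    (hdet : (G x).det ≠ 0) (a l i j : Fin 2) :
    ∑ k, G x l k * pd a (christoffel G k i j) x = pd a (christoffelFirst G l i j) x
      - ∑ k, pd a (fun y => G y l k) x * christoffel G k i j x := by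
  have hev : christoffelFirst G l i j =ᶠ[𝓝 x]
      fun y => G y l 0 * christoffel G 0 i j y + G y l 1 * christoffel G 1 i j y := by
    filter_upwards [eventually_det_ne_zero hG hdet] with y hy
    rw [← sum_mul_christoffel hy, Fin.sum_univ_two]
  have d (i j) := (hG i j).differentiableAt (n := ∞) (by simp)
  have dΓ (k) := (contDiffAt_christoffel hG hdet k i j).differentiableAt (n := ∞) (by simp)
  rw [pd_congr hev, pd_add ((d _ _).fun_mul (dΓ _)) ((d _ _).fun_mul (dΓ _)), pd_mul (d _ _) (dΓ _),
    pd_mul (d _ _) (dΓ _)]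
  simp only [Fin.sum_univ_two]
  ring

/-- Brioschi's formula for the Gaussian curvature. -/
theorem det_mul_gaussCoord (hG : ∀ i j, ContDiffAt ℝ ∞ (fun y => G y i j) x)
    (hsymm : ∀ y i j, G y i j = G y j i) (hdet : (G x).det ≠ 0) :
    (G x).det * gaussCoord G x =
      pd 0 (pd 1 (fun y => G y 0 1)) x - (1 / 2) * pd 0 (pd 0 (fun y => G y 1 1)) x
        - (1 / 2) * pd 1 (pd 1 (fun y => G y 0 0)) x
        - ∑ l, (christoffelFirst G l 0 0 x * christoffel G l 1 1 x
            - christoffelFirst G l 0 1 x * christoffel G l 0 1 x) := by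
  have hs : (fun y => G y 1 0) = fun y => G y 0 1 := funext fun y => hsymm y 1 0
  have hΓ (k : Fin 2) (y) : christoffel G k 1 0 y = christoffel G k 0 1 y := by
    simp only [christoffel, hs]
    refine congrArg _ (Finset.sum_congr rfl fun l _ => by ring)
  have h0 := sum_mul_pd_christoffel hG hdet 0 0 1 1
  have h1 := sum_mul_pd_christoffel hG hdet 1 0 0 1
  have c0 := sum_mul_christoffel hdet 0 0 0
  have c1 := sum_mul_christoffel hdet 0 0 1
  have c2 := sum_mul_christoffel hdet 0 1 1
  have e0 : pd 0 (christoffelFirst G 0 1 1) x =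
      pd 0 (pd 1 (fun y => G y 0 1)) x - (1 / 2) * pd 0 (pd 0 (fun y => G y 1 1)) x := by
    have : christoffelFirst G 0 1 1 =
        fun y => pd 1 (fun y => G y 0 1) y - (1 / 2) * pd 0 (fun y => G y 1 1) y := by
      funext y; simp only [christoffelFirst, hs]; ring
    rw [this, pd_sub (differentiableAt_pd (hG _ _))
      ((differentiableAt_const _).fun_mul (differentiableAt_pd (hG _ _))),
      pd_const_mul _ (differentiableAt_pd (hG _ _))]
  have e1 : pd 1 (christoffelFirst G 0 0 1) x = (1 / 2) * pd 1 (pd 1 (fun y => G y 0 0)) x := by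
    have : christoffelFirst G 0 0 1 = fun y => (1 / 2) * pd 1 (fun y => G y 0 0) y := by
      funext y; simp only [christoffelFirst, hs]; ring
    rw [this, pd_const_mul _ (differentiableAt_pd (hG _ _))]
  have hmain : (G x).det * gaussCoord G x = ∑ l, G x l 0 * riemann G l 0 1 1 x := by
    rw [gaussCoord, mul_div_cancel₀ _ hdet]
  rw [hmain]
  rw [e0] at h0
  rw [e1] at h1
  simp only [Fin.sum_univ_two, riemann, hΓ, hsymm x 1 0] at *
  simp only [christoffelFirst, hs] at *
  -- `h0` and `h1` lower the index of the differentiated Christoffel symbols, `c0`, `c1`, `c2` that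
  -- of the quadratic terms.
  linear_combination h0 - h1 + christoffel G 0 1 1 x * c0 + christoffel G 1 1 1 x * c1
    - christoffel G 0 0 1 x * c1 - christoffel G 1 0 1 x * c2

end Gauss

/-! ### The theorema egregium -/

section Egregium

variable {V : Type*} [NormedAddCommGroup V] [InnerProductSpace ℝ V] {x : Plane}

theorem eventually_differentiableAt {W : Type*} [NormedAddCommGroup W] [NormedSpace ℝ W]
    {F : Plane → W} (h : ContDiffAt ℝ ∞ F x) : ∀ᶠ y in 𝓝 x, DifferentiableAt ℝ F y := by
  filter_upwards [(h.of_le (m := 1) (by exact mod_cast le_top)).eventually (by simp)] with y hy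
  exact hy.differentiableAt (by simp)

/-- The Gram matrix `⟨T_i, T_j⟩` of a pair of vector-valued functions. -/
def gram (T : Fin 2 → Plane → V) (x : Plane) : Matrix (Fin 2) (Fin 2) ℝ :=
  Matrix.of fun i j => inner ℝ (T i x) (T j x)

theorem gram_apply (T : Fin 2 → Plane → V) (x : Plane) (i j : Fin 2) :
    gram T x i j = inner ℝ (T i x) (T j x) := rfl

theorem gram_symm (T : Fin 2 → Plane → V) (x : Plane) (i j : Fin 2) :
    gram T x i j = gram T x j i := real_inner_comm _ _

theorem contDiffAt_gram {T : Fin 2 → Plane → V} (hT : ∀ i, ContDiffAt ℝ ∞ (T i) x)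
    (i j : Fin 2) : ContDiffAt ℝ ∞ (fun y => gram T y i j) x :=
  (hT i).inner ℝ (hT j)

theorem pd_gram {T : Fin 2 → Plane → V} (hT : ∀ i, DifferentiableAt ℝ (T i) x)
    (k i j : Fin 2) : pd k (fun y => gram T y i j) x =
      inner ℝ (T i x) (pd k (T j) x) + inner ℝ (pd k (T i) x) (T j x) :=
  pd_inner (hT i) (hT j)

theorem pd_pd_gram {T : Fin 2 → Plane → V} (hT : ∀ i, ContDiffAt ℝ ∞ (T i) x)
    (l k i j : Fin 2) : pd l (pd k (fun y => gram T y i j)) x =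
      inner ℝ (T i x) (pd l (pd k (T j)) x) + inner ℝ (pd l (T i) x) (pd k (T j) x) +
      (inner ℝ (pd k (T i) x) (pd l (T j) x) + inner ℝ (pd l (pd k (T i)) x) (T j x)) := by
  have d (i) := (hT i).differentiableAt (n := ∞) (by simp)
  have hev : pd k (fun y => gram T y i j) =ᶠ[𝓝 x] fun y =>
      inner ℝ (T i y) (pd k (T j) y) + inner ℝ (pd k (T i) y) (T j y) := by
    filter_upwards [eventually_differentiableAt (hT i), eventually_differentiableAt (hT j)]
      with y hi hj using pd_inner hi hj
  rw [pd_congr hev, pd_add ((d i).inner ℝ (differentiableAt_pd (hT j)))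
    ((differentiableAt_pd (hT i)).inner ℝ (d j)), pd_inner (d i) (differentiableAt_pd (hT j)),
    pd_inner (differentiableAt_pd (hT i)) (d j)]

/-- Koszul's computation: closedness makes `∂_i T_j` symmetric in `i, j`, and all but two equal
terms cancel. The `T_i` need not be given as partial derivatives of a map. -/
theorem christoffelFirst_gram {T : Fin 2 → Plane → V} (hT : ∀ i, DifferentiableAt ℝ (T i) x)
    (hclosed : pd 0 (T 1) x = pd 1 (T 0) x) (l i j : Fin 2) :
    christoffelFirst (gram T) l i j x = inner ℝ (T l x) (pd i (T j) x) := by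
  have hc (i j : Fin 2) : pd i (T j) x = pd j (T i) x := by
    fin_cases i <;> fin_cases j <;> simp [hclosed]
  simp only [christoffelFirst, pd_gram hT]
  rw [hc j i, hc l i, hc l j, real_inner_comm (T l x), real_inner_comm (T j x) (pd i (T l) x)]
  ring

/-- If `∂_0 T_1 = ∂_1 T_0` and `∂_i T_j = ∑ a^k_{ij} T_k + h_{ij} n` with a unit vector `n`
orthogonal to the `T_k`, then the Gaussian curvature of the metric `⟨T_i, T_j⟩` is
`det (h_{ij}) / det (g_{ij})`. -/
theorem gram_det_mul_gaussCoord {T : Fin 2 → Plane → V} (hT : ∀ i, ContDiffAt ℝ ∞ (T i) x)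
    (hclosed : pd 0 (T 1) =ᶠ[𝓝 x] pd 1 (T 0)) (hdet : (gram T x).det ≠ 0) {n : V}
    (hn : ‖n‖ = 1) (hnT : ∀ i, inner ℝ (T i x) n = 0) {a : Fin 2 → Fin 2 → Fin 2 → ℝ}
    {h : Fin 2 → Fin 2 → ℝ}
    (hgauss : ∀ i j, pd i (T j) x = ∑ k, a k i j • T k x + h i j • n) :
    (gram T x).det * gaussCoord (gram T) x = h 0 0 * h 1 1 - h 0 1 ^ 2 := by
  have d (i) := (hT i).differentiableAt (n := ∞) (by simp)
  have hnn : inner ℝ n n = (1 : ℝ) := by rw [real_inner_self_eq_norm_sq, hn]; norm_num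
  have hTn (i) : inner ℝ n (T i x) = (0 : ℝ) := by rw [real_inner_comm]; exact hnT i
  have hcf (l i j : Fin 2) :
      christoffelFirst (gram T) l i j x = ∑ k, gram T x l k * a k i j := by
    rw [christoffelFirst_gram d hclosed.eq_of_nhds, hgauss]
    simp only [inner_add_right, inner_sum, inner_smul_right, hnT, gram_apply]
    simp [mul_comm]
  have hinv : (gram T x)⁻¹ * gram T x = 1 :=
    Matrix.nonsing_inv_mul _ (isUnit_iff_ne_zero.2 hdet)
  -- The tangential coefficients are forced: they are the Christoffel symbols of the Gram matrix.
  have hch (l i j : Fin 2) : christoffel (gram T) l i j x = a l i j := by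
    rw [christoffel_eq]
    simp only [hcf, Finset.mul_sum]
    rw [Finset.sum_comm]
    calc ∑ k, ∑ m, (gram T x)⁻¹ l m * (gram T x m k * a k i j)
        = ∑ k, ((gram T x)⁻¹ * gram T x) l k * a k i j := by
          simp only [Matrix.mul_apply, Finset.sum_mul, mul_assoc]
      _ = _ := by rw [hinv]; simp [Matrix.one_apply]
  -- With `e1` and `e2` all second derivatives of `T` in Brioschi's formula cancel. What remains is
  -- `⟨∂₀T₀, ∂₁T₁⟩ - |∂₀T₁|²` minus its tangential part, which is `det h`.
  have e1 : pd 0 (pd 1 (T 1)) x = pd 1 (pd 1 (T 0)) x := by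
    rw [pd_pd_comm (hT 1), pd_congr hclosed]
  have e2 : pd 0 (pd 0 (T 1)) x = pd 0 (pd 1 (T 0)) x := pd_congr hclosed
  rw [det_mul_gaussCoord (contDiffAt_gram hT) (gram_symm T) hdet, pd_pd_gram hT, pd_pd_gram hT,
    pd_pd_gram hT]
  simp only [hcf, hch]
  rw [e1, e2, real_inner_comm (pd 0 (pd 1 (T 0)) x) (T 1 x),
    real_inner_comm (pd 1 (pd 1 (T 0)) x) (T 0 x), ← hclosed.eq_of_nhds, hgauss, hgauss, hgauss]
  simp only [inner_add_right, inner_add_left, inner_smul_right,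
    real_inner_smul_left, hnT, hTn, hnn, gram_apply, Fin.sum_univ_two]
  rw [real_inner_comm (T 0 x) (T 1 x)]
  ring

end Egregium

/-! ### Conformal change of the metric -/

section Conformal

variable {G : Plane → Matrix (Fin 2) (Fin 2) ℝ} {x : Plane}

/-- The Laplacian `∑ g^{ij} (∂_i ∂_j u - ∑_k Γ^k_{ij} ∂_k u)`. -/
def laplacian (G : Plane → Matrix (Fin 2) (Fin 2) ℝ) (u : Plane → ℝ) (x : Plane) : ℝ :=
  ∑ i, ∑ j, (G x)⁻¹ i j * (pd i (pd j u) x - ∑ k, christoffel G k i j x * pd k u x)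

/-- Meant for `u = log f`: the conformal factor `c f^s` has exponent `(s/2) log f + (log c)/2`. -/
theorem laplacian_const_mul_add {u : Plane → ℝ} (hu : ContDiffAt ℝ ∞ u x) (c b : ℝ) :
    laplacian G (fun y => c * u y + b) x = c * laplacian G u x := by
  have h1 (i : Fin 2) {y} (hy : DifferentiableAt ℝ u y) :
      pd i (fun y => c * u y + b) y = c * pd i u y := by
    rw [pd_add (hy.const_mul c) (differentiableAt_const b), pd_const_mul c hy, pd_const, add_zero]
  have h2 (i j : Fin 2) : pd i (pd j (fun y => c * u y + b)) x = c * pd i (pd j u) x := by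
    have hev : pd j (fun y => c * u y + b) =ᶠ[𝓝 x] fun y => c * pd j u y := by
      filter_upwards [eventually_differentiableAt hu] with y hy using h1 j hy
    rw [pd_congr hev, pd_const_mul c (differentiableAt_pd hu)]
  simp only [laplacian, h1 _ (hu.differentiableAt (by simp)), h2, Fin.sum_univ_two]
  ring

theorem pd_exp_two_mul {u : Plane → ℝ} (hu : DifferentiableAt ℝ u x) (k : Fin 2) :
    pd k (fun y => Real.exp (2 * u y)) x = Real.exp (2 * u x) * (2 * pd k u x) := by
  rw [pd_comp (Real.hasDerivAt_exp _) (hu.const_mul 2), pd_const_mul 2 hu]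

theorem pd_exp_two_mul_mul {u v : Plane → ℝ} (hu : DifferentiableAt ℝ u x)
    (hv : DifferentiableAt ℝ v x) (k : Fin 2) :
    pd k (fun y => Real.exp (2 * u y) * v y) x =
      Real.exp (2 * u x) * (pd k v x + 2 * pd k u x * v x) := by
  rw [pd_mul (hu.const_mul 2).exp hv, pd_exp_two_mul hu]
  ring

theorem pd_pd_exp_two_mul_mul {u v : Plane → ℝ} (hu : ContDiffAt ℝ ∞ u x)
    (hv : ContDiffAt ℝ ∞ v x) (l k : Fin 2) :
    pd l (pd k (fun y => Real.exp (2 * u y) * v y)) x =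
      Real.exp (2 * u x) * (pd l (pd k v) x + 2 * pd l (pd k u) x * v x
        + 2 * pd k u x * pd l v x + 2 * pd l u x * pd k v x
        + 4 * pd k u x * pd l u x * v x) := by
  have du := hu.differentiableAt (n := ∞) (by simp)
  have dv := hv.differentiableAt (n := ∞) (by simp)
  have hev : pd k (fun y => Real.exp (2 * u y) * v y) =ᶠ[𝓝 x]
      fun y => Real.exp (2 * u y) * (pd k v y + 2 * pd k u y * v y) := by
    filter_upwards [eventually_differentiableAt hu, eventually_differentiableAt hv] with y h1 h2
      using pd_exp_two_mul_mul h1 h2 k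
  have d1 : DifferentiableAt ℝ (fun y => 2 * pd k u y) x := (differentiableAt_pd hu).const_mul 2
  rw [pd_congr hev, pd_exp_two_mul_mul du ((differentiableAt_pd hv).fun_add (d1.fun_mul dv)),
    pd_add (differentiableAt_pd hv) (d1.fun_mul dv), pd_mul d1 dv,
    pd_const_mul 2 (differentiableAt_pd hu)]
  ring

/-- The Gaussian curvature of a conformal metric, `e^{2u} K(e^{2u} g) = K(g) - Δu`. -/
theorem exp_mul_gaussCoord_conformal (hG : ∀ i j, ContDiffAt ℝ ∞ (fun y => G y i j) x)
    (hsymm : ∀ y i j, G y i j = G y j i) (hdet : (G x).det ≠ 0) {u : Plane → ℝ}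
    (hu : ContDiffAt ℝ ∞ u x) :
    Real.exp (2 * u x) * gaussCoord (fun y => Real.exp (2 * u y) • G y) x =
      gaussCoord G x - laplacian G u x := by
  have du := hu.differentiableAt (n := ∞) (by simp)
  have dG (i j) := (hG i j).differentiableAt (n := ∞) (by simp)
  have hG' (i j) : ContDiffAt ℝ ∞ (fun y => (Real.exp (2 * u y) • G y) i j) x :=
    (contDiffAt_const.mul hu).exp.mul (hG i j)
  have hdet' : (Real.exp (2 * u x) • G x).det = Real.exp (2 * u x) ^ 2 * (G x).det := by
    rw [Matrix.det_smul]; simp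
  have hne := Real.exp_ne_zero (2 * u x)
  have h1 := det_mul_gaussCoord hG hsymm hdet
  have h2 := det_mul_gaussCoord (G := fun y => Real.exp (2 * u y) • G y) hG'
    (fun y i j => by simp [hsymm y i j]) (by rw [hdet']; positivity)
  have hs : (fun y => G y 1 0) = fun y => G y 0 1 := funext fun y => hsymm y 1 0
  have huc : pd 1 (pd 0 u) x = pd 0 (pd 1 u) x := pd_pd_comm hu
  simp only [hdet'] at h2
  rw [Matrix.det_fin_two, hsymm x 1 0] at h1 h2 hdet
  -- Multiplying by the determinant lets Brioschi's formula replace both curvatures, leaving a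
  -- rational identity in the derivatives of `G` and `u` up to order two.
  suffices hmul : Real.exp (2 * u x) * (G x 0 0 * G x 1 1 - G x 0 1 * G x 0 1) *
      (Real.exp (2 * u x) * gaussCoord (fun y => Real.exp (2 * u y) • G y) x) =
      Real.exp (2 * u x) * (G x 0 0 * G x 1 1 - G x 0 1 * G x 0 1) *
      (gaussCoord G x - laplacian G u x) from
    mul_left_cancel₀ (mul_ne_zero hne hdet) hmul
  rw [mul_sub _ (gaussCoord G x), mul_assoc (Real.exp (2 * u x)) _ (gaussCoord G x), h1]
  refine Eq.trans (by ring) (h2.trans ?_)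
  clear h1 h2
  simp only [christoffel_eq, christoffelFirst, laplacian, Matrix.smul_apply, smul_eq_mul,
    pd_pd_exp_two_mul_mul hu (hG _ _), pd_exp_two_mul_mul du (dG _ _), Fin.sum_univ_two,
    matrix_inv_apply, hs, huc, hsymm x 1 0]
  simp only [Matrix.of_apply, Matrix.cons_val', Matrix.cons_val_zero, Matrix.cons_val_one,
    Matrix.cons_val_fin_one]
  generalize Real.exp (2 * u x) = φ at *
  generalize G x 0 0 = E at *
  generalize G x 0 1 = F at *
  generalize G x 1 1 = H at *
  have e : φ * E * (φ * H) - φ * F * (φ * F) = φ ^ 2 * (E * H - F ^ 2) := by ring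
  rw [← pow_two] at hdet
  rw [e, mul_inv, ← pow_two F]
  generalize hΔ : E * H - F ^ 2 = Δ at *
  field_simp
  rw [← hΔ]
  ring

end Conformal

/-! ### Surface patches in `ℝ³` -/

/-- The matrix with rows `u 0, u 1, n` has squared determinant equal to the Gram determinant of `u`,
so it is invertible, and it kills `R`. -/
theorem eq_zero_of_inner_eq_zero {u : Fin 2 → Space} {n R : Space}
    (hdet : (Matrix.of fun i j => (inner ℝ (u i) (u j) : ℝ)).det ≠ 0)
    (hn : ‖n‖ = 1) (hun : ∀ i, inner ℝ (u i) n = 0) (hR : ∀ i, inner ℝ (u i) R = 0)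
    (hnR : inner ℝ n R = 0) : R = 0 := by
  have hnn : inner ℝ n n = (1 : ℝ) := by rw [real_inner_self_eq_norm_sq, hn]; norm_num
  set A : Matrix (Fin 3) (Fin 3) ℝ := Matrix.of ![(u 0).ofLp, (u 1).ofLp, n.ofLp] with hA
  have hin (a b : Space) : inner ℝ a b = a 0 * b 0 + a 1 * b 1 + a 2 * b 2 := by
    simp [PiLp.inner_apply, Fin.sum_univ_three, mul_comm]
  have h0 := hun 0
  have h1 := hun 1
  have hR0 := hR 0
  have hR1 := hR 1
  rw [Matrix.det_fin_two] at hdet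
  simp only [Matrix.of_apply, hin] at hdet hnn h0 h1 hR0 hR1 hnR
  have hsq : A.det ^ 2 ≠ 0 := by
    have : A.det ^ 2 = (A * A.transpose).det := by
      rw [Matrix.det_mul, Matrix.det_transpose]; ring
    rw [this, Matrix.det_fin_three]
    simp only [hA, Matrix.mul_apply, Fin.sum_univ_three, Matrix.transpose_apply, Matrix.of_apply,
      Matrix.cons_val_zero, Matrix.cons_val_one, Matrix.cons_val]
    rw [h0, h1, hnn]
    simpa using hdet
  have hker : A.mulVec R.ofLp = 0 := by
    ext i
    fin_cases i <;>
      simp [hA, Matrix.mulVec, dotProduct, Fin.sum_univ_three, hR0, hR1, hnR]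
  have := Matrix.eq_zero_of_mulVec_eq_zero (by simpa using hsq) hker
  ext i
  exact congrFun this i

/-- Expansion of a vector of `ℝ³` in a basis of two vectors and a unit vector orthogonal to
both. -/
theorem eq_sum_smul_add_smul {T : Fin 2 → Plane → Space} {x : Plane} {n : Space}
    (hdet : (gram T x).det ≠ 0) (hn : ‖n‖ = 1) (hTn : ∀ i, inner ℝ (T i x) n = 0) (W : Space) :
    W = ∑ k, (∑ l, (gram T x)⁻¹ k l * inner ℝ (T l x) W) • T k x + (inner ℝ n W : ℝ) • n := by
  have hnn : inner ℝ n n = (1 : ℝ) := by rw [real_inner_self_eq_norm_sq, hn]; norm_num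
  have hnT (i) : inner ℝ n (T i x) = (0 : ℝ) := by rw [real_inner_comm]; exact hTn i
  have hmul : gram T x * (gram T x)⁻¹ = 1 :=
    Matrix.mul_nonsing_inv _ (isUnit_iff_ne_zero.2 hdet)
  rw [← sub_eq_zero]
  refine eq_zero_of_inner_eq_zero (u := fun i => T i x) hdet hn hTn (fun i => ?_) ?_
  · have : ∑ k, (∑ l, (gram T x)⁻¹ k l * inner ℝ (T l x) W) * inner ℝ (T i x) (T k x)
        = inner ℝ (T i x) W := by
      calc _ = ∑ l, ∑ k, gram T x i k * (gram T x)⁻¹ k l * inner ℝ (T l x) W := by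
            rw [Finset.sum_comm]
            simp only [Finset.sum_mul, gram_apply]
            exact Finset.sum_congr rfl fun _ _ => Finset.sum_congr rfl fun _ _ => by ring
        _ = ∑ l, (gram T x * (gram T x)⁻¹) i l * inner ℝ (T l x) W := by
            simp only [Matrix.mul_apply, Finset.sum_mul]
        _ = _ := by rw [hmul]; simp [Matrix.one_apply]
    simp only [inner_sub_right, inner_add_right, inner_sum, inner_smul_right, hTn, this]
    ring
  · simp only [inner_sub_right, inner_add_right, inner_sum, inner_smul_right, hnT, hnn]
    simp

/-- A parametrized surface `X : U → ℝ³` with unit normal field `N`. -/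
structure IsPatch (U : Set Plane) (X N : Plane → Space) : Prop where
  isOpen : IsOpen U
  contDiffAt : ∀ y ∈ U, ContDiffAt ℝ ∞ X y
  contDiffAt_normal : ∀ y ∈ U, ContDiffAt ℝ ∞ N y
  norm_normal : ∀ y ∈ U, ‖N y‖ = 1
  inner_normal : ∀ y ∈ U, ∀ i, inner ℝ (pd i X y) (N y) = 0
  det_ne_zero : ∀ y ∈ U, (gram (fun i => pd i X) y).det ≠ 0

/-- The first fundamental form `⟨∂_i X, ∂_j X⟩`. -/
abbrev firstForm (X : Plane → Space) : Plane → Matrix (Fin 2) (Fin 2) ℝ := gram (fun i => pd i X)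

/-- The second fundamental form `⟨∂_i ∂_j X, N⟩`. -/
def secondForm (X N : Plane → Space) (i j : Fin 2) (x : Plane) : ℝ :=
  inner ℝ (pd i (pd j X) x) (N x)

/-- The mean curvature function, the trace of the second fundamental form. -/
def meanCoord (X N : Plane → Space) (x : Plane) : ℝ :=
  ∑ i, ∑ j, (firstForm X x)⁻¹ i j * secondForm X N i j x

/-! ### Gauss and Weingarten formulas, tension field and stress-energy tensor -/

namespace IsPatch

variable {U : Set Plane} {X N : Plane → Space} (h : IsPatch U X N) {x : Plane}
include h

theorem contDiffAt_pd_coord (hx : x ∈ U) (i : Fin 2) : ContDiffAt ℝ ∞ (pd i X) x :=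
  contDiffAt_pd (h.contDiffAt x hx)

theorem contDiffAt_firstForm (hx : x ∈ U) (i j : Fin 2) :
    ContDiffAt ℝ ∞ (fun y => firstForm X y i j) x :=
  contDiffAt_gram (h.contDiffAt_pd_coord hx) i j

theorem contDiffAt_secondForm (hx : x ∈ U) (i j : Fin 2) :
    ContDiffAt ℝ ∞ (secondForm X N i j) x :=
  (contDiffAt_pd (h.contDiffAt_pd_coord hx j)).inner ℝ (h.contDiffAt_normal x hx)

theorem contDiffAt_meanCoord (hx : x ∈ U) : ContDiffAt ℝ ∞ (meanCoord X N) x :=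
  ContDiffAt.sum fun i _ => ContDiffAt.sum fun j _ =>
    (contDiffAt_inv (h.contDiffAt_firstForm hx) (h.det_ne_zero x hx) i j).mul
      (h.contDiffAt_secondForm hx i j)

theorem secondForm_symm (hx : x ∈ U) (i j : Fin 2) :
    secondForm X N i j x = secondForm X N j i x := by
  rw [secondForm, pd_pd_comm (h.contDiffAt x hx), secondForm]

theorem eventually_mem (hx : x ∈ U) : ∀ᶠ y in 𝓝 x, y ∈ U := h.isOpen.mem_nhds hx

theorem inner_pd_normal (hx : x ∈ U) (i j : Fin 2) :
    inner ℝ (pd i X x) (pd j N x) = -secondForm X N j i x := by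
  have h0 : (fun y => (inner ℝ (pd i X y) (N y) : ℝ)) =ᶠ[𝓝 x] fun _ => 0 := by
    filter_upwards [h.eventually_mem hx] with y hy using h.inner_normal y hy i
  have h1 := pd_congr (i := j) h0
  rw [pd_const, pd_inner ((h.contDiffAt_pd_coord hx i).differentiableAt (by simp))
    ((h.contDiffAt_normal x hx).differentiableAt (by simp))] at h1
  rw [secondForm]
  linarith

theorem normal_inner_self (hx : x ∈ U) : inner ℝ (N x) (N x) = (1 : ℝ) := by
  rw [real_inner_self_eq_norm_sq, h.norm_normal x hx]; norm_num

theorem normal_inner_pd_normal (hx : x ∈ U) (j : Fin 2) :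
    inner ℝ (N x) (pd j N x) = (0 : ℝ) := by
  have h0 : (fun y => (inner ℝ (N y) (N y) : ℝ)) =ᶠ[𝓝 x] fun _ => 1 := by
    filter_upwards [h.eventually_mem hx] with y hy using h.normal_inner_self hy
  have h1 := pd_congr (i := j) h0
  have d := (h.contDiffAt_normal x hx).differentiableAt (n := ∞) (by simp)
  rw [pd_const, pd_inner d d, real_inner_comm (pd j N x)] at h1
  linarith [real_inner_comm (pd j N x) (N x)]

theorem christoffel_firstForm (hx : x ∈ U) (k i j : Fin 2) :
    christoffel (firstForm X) k i j x =
      ∑ l, (firstForm X x)⁻¹ k l * inner ℝ (pd l X x) (pd i (pd j X) x) := by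
  rw [christoffel_eq]
  refine Finset.sum_congr rfl fun l _ => ?_
  rw [christoffelFirst_gram (fun i => (h.contDiffAt_pd_coord hx i).differentiableAt (by simp))
    (pd_pd_comm (h.contDiffAt x hx))]

/-- The Gauss formula. -/
theorem pd_pd_eq (hx : x ∈ U) (i j : Fin 2) :
    pd i (pd j X) x =
      ∑ k, christoffel (firstForm X) k i j x • pd k X x + secondForm X N i j x • N x := by
  simp only [h.christoffel_firstForm hx]
  conv_lhs => rw [eq_sum_smul_add_smul (T := fun i => pd i X) (h.det_ne_zero x hx)
    (h.norm_normal x hx) (h.inner_normal x hx) (pd i (pd j X) x)]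
  rw [real_inner_comm]
  rfl

/-- The Gauss equation: the Gaussian curvature is `det (h_{ij}) / det (g_{ij})`. -/
theorem det_mul_gaussCoord (hx : x ∈ U) :
    (firstForm X x).det * gaussCoord (firstForm X) x =
      secondForm X N 0 0 x * secondForm X N 1 1 x - secondForm X N 0 1 x ^ 2 :=
  gram_det_mul_gaussCoord (h.contDiffAt_pd_coord hx)
    (by filter_upwards [h.eventually_mem hx] with y hy using pd_pd_comm (h.contDiffAt y hy))
    (h.det_ne_zero x hx) (h.norm_normal x hx) (h.inner_normal x hx) (h.pd_pd_eq hx)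

/-- The Christoffel terms in the tension field remove exactly the tangential part in the Gauss
formula. -/
theorem tension_eq (hx : x ∈ U) : tension (firstForm X) X x = meanCoord X N x • N x := by
  simp only [tension, meanCoord, h.pd_pd_eq hx, add_sub_cancel_left, Finset.sum_smul, mul_smul]

/-- Since `τ = f N`, Weingarten gives `⟨∂_k X, ∂_l τ⟩ = -f h_{kl}` with trace `-f²`, and `f²/2 - f²
= -f²/2`. -/
theorem stressEnergy_eq (hx : x ∈ U) (i j : Fin 2) :
    stressEnergy (firstForm X) X i j x =
      -(1 / 2) * meanCoord X N x ^ 2 * firstForm X x i j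
        + 2 * meanCoord X N x * secondForm X N i j x := by
  have hτ (k : Fin 2) : pd k (tension (firstForm X) X) x =
      meanCoord X N x • pd k N x + pd k (meanCoord X N) x • N x := by
    have : tension (firstForm X) X =ᶠ[𝓝 x] fun y => meanCoord X N y • N y := by
      filter_upwards [h.eventually_mem hx] with y hy using h.tension_eq hy
    rw [pd_congr this, pd_smul ((h.contDiffAt_meanCoord hx).differentiableAt (by simp))
      ((h.contDiffAt_normal x hx).differentiableAt (by simp))]
  have hin (k l : Fin 2) : inner ℝ (pd k X x) (pd l (tension (firstForm X) X) x) =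
      -(meanCoord X N x * secondForm X N k l x) := by
    rw [hτ, inner_add_right, inner_smul_right, inner_smul_right, h.inner_pd_normal hx,
      h.inner_normal x hx, h.secondForm_symm hx]
    ring
  have hsum : ∑ k, ∑ l, (firstForm X x)⁻¹ k l * -(meanCoord X N x * secondForm X N k l x) =
      -(meanCoord X N x * meanCoord X N x) := by
    conv_rhs => enter [1, 2]; rw [meanCoord]
    rw [← neg_mul]
    simp only [Finset.mul_sum]
    exact Finset.sum_congr rfl fun _ _ => Finset.sum_congr rfl fun _ _ => by ring
  simp only [stressEnergy, hin, hsum, h.tension_eq hx, norm_smul, h.norm_normal x hx, mul_one,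
    Real.norm_eq_abs, sq_abs, h.secondForm_symm hx j i]
  ring

end IsPatch

theorem firstForm_apply (X : Plane → Space) (x : Plane) (i j : Fin 2) :
    firstForm X x i j = inner ℝ (pd i X x) (pd j X x) := rfl

theorem firstForm_symm (X : Plane → Space) (x : Plane) (i j : Fin 2) :
    firstForm X x i j = firstForm X x j i := gram_symm _ x i j

theorem firstForm_det (X : Plane → Space) (x : Plane) : (firstForm X x).det =
    firstForm X x 0 0 * firstForm X x 1 1 - firstForm X x 0 1 * firstForm X x 0 1 := by
  rw [Matrix.det_fin_two, firstForm_symm X x 1 0]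

/-- The covariant derivative of the second fundamental form. -/
def covSecondForm (X N : Plane → Space) (i k j : Fin 2) (x : Plane) : ℝ :=
  pd i (secondForm X N k j) x - ∑ m, christoffel (firstForm X) m i k x * secondForm X N m j x
    - ∑ m, christoffel (firstForm X) m i j x * secondForm X N k m x

/-! ### Codazzi equation and divergence of the stress-energy tensor -/

namespace IsPatch

variable {U : Set Plane} {X N : Plane → Space} (h : IsPatch U X N) {x : Plane}
include h

theorem christoffel_symm (hx : x ∈ U) (k i j : Fin 2) :
    christoffel (firstForm X) k i j x = christoffel (firstForm X) k j i x := by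
  simp only [h.christoffel_firstForm hx, pd_pd_comm (i := i) (h.contDiffAt x hx)]

theorem pd_firstForm (hx : x ∈ U) (k i j : Fin 2) :
    pd k (fun y => firstForm X y i j) x =
      ∑ m, (firstForm X x i m * christoffel (firstForm X) m k j x
        + firstForm X x j m * christoffel (firstForm X) m k i x) := by
  have d (i) := (h.contDiffAt_pd_coord hx i).differentiableAt (n := ∞) (by simp)
  have hc := pd_pd_comm (i := 0) (j := 1) (h.contDiffAt x hx)
  rw [Finset.sum_add_distrib, sum_mul_christoffel (h.det_ne_zero x hx),
    sum_mul_christoffel (h.det_ne_zero x hx), christoffelFirst_gram d hc,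
    christoffelFirst_gram d hc, pd_gram d, real_inner_comm (pd j X x)]

theorem pd_secondForm (hx : x ∈ U) (k i j : Fin 2) :
    pd k (secondForm X N i j) x = inner ℝ (pd k (pd i (pd j X)) x) (N x)
      - ∑ m, christoffel (firstForm X) m i j x * secondForm X N m k x := by
  have e : inner ℝ (pd i (pd j X) x) (pd k N x) =
      -∑ m, christoffel (firstForm X) m i j x * secondForm X N m k x := by
    rw [h.pd_pd_eq hx]
    simp only [inner_add_left, sum_inner, real_inner_smul_left, h.inner_pd_normal hx,
      h.normal_inner_pd_normal hx, mul_zero, add_zero, mul_neg, Finset.sum_neg_distrib,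
      h.secondForm_symm hx k]
  have d := (contDiffAt_pd (i := i) (h.contDiffAt_pd_coord hx j)).differentiableAt
    (n := ∞) (by simp)
  have := pd_inner (i := k) d ((h.contDiffAt_normal x hx).differentiableAt (by simp))
  rw [e] at this
  refine Eq.trans this ?_
  ring

theorem covSecondForm_comm (hx : x ∈ U) (i k j : Fin 2) :
    covSecondForm X N i k j x = covSecondForm X N i j k x := by
  have hev : secondForm X N k j =ᶠ[𝓝 x] secondForm X N j k := by
    filter_upwards [h.eventually_mem hx] with y hy using h.secondForm_symm hy k j
  simp only [covSecondForm, pd_congr hev, h.secondForm_symm hx _ j, h.secondForm_symm hx _ k]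
  ring

/-- The Codazzi equation. -/
theorem covSecondForm_symm (hx : x ∈ U) (i k j : Fin 2) :
    covSecondForm X N i k j x = covSecondForm X N j i k x := by
  -- By `pd_secondForm`, `∇h` is the normal part of the third derivatives of `X` minus three terms
  -- `Γ h` that the indices permute; only symmetry of the third derivatives is missing.
  have e1 : pd i (pd k (pd j X)) x = pd j (pd i (pd k X)) x := by
    have hev : pd k (pd j X) =ᶠ[𝓝 x] pd j (pd k X) := by
      filter_upwards [h.eventually_mem hx] with y hy using pd_pd_comm (h.contDiffAt y hy)
    rw [pd_congr hev, pd_pd_comm (h.contDiffAt_pd_coord hx k)]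
  simp only [covSecondForm, h.pd_secondForm hx, e1, h.christoffel_symm hx _ j,
    h.secondForm_symm hx k, h.secondForm_symm hx i]
  rw [Finset.sum_congr rfl fun m _ => by rw [h.christoffel_symm hx m k j]]
  ring

/-- The trace with denominators cleared; differentiating this form avoids derivatives of the inverse
matrix. -/
theorem meanCoord_mul_det (hx : x ∈ U) :
    meanCoord X N x * (firstForm X x 0 0 * firstForm X x 1 1
        - firstForm X x 0 1 * firstForm X x 0 1) =
      firstForm X x 1 1 * secondForm X N 0 0 x - 2 * firstForm X x 0 1 * secondForm X N 0 1 x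
        + firstForm X x 0 0 * secondForm X N 1 1 x := by
  have hd := h.det_ne_zero x hx
  rw [firstForm_det] at hd
  simp only [meanCoord, Fin.sum_univ_two, matrix_inv_apply, firstForm_symm X x 1 0,
    h.secondForm_symm hx 1 0, Matrix.of_apply, Matrix.cons_val', Matrix.cons_val_zero,
    Matrix.cons_val_one, Matrix.cons_val_fin_one]
  generalize hΔ : firstForm X x 0 0 * firstForm X x 1 1
    - firstForm X x 0 1 * firstForm X x 0 1 = Δ at *
  field_simp
  ring

/-- The divergence of the second fundamental form is the differential of the mean curvature. -/
theorem div_secondForm (hx : x ∈ U) (j : Fin 2) :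
    ∑ i, ∑ k, (firstForm X x)⁻¹ i k * covSecondForm X N i k j x = pd j (meanCoord X N) x := by
  have hd := h.det_ne_zero x hx
  have hf := h.meanCoord_mul_det hx
  have df := (h.contDiffAt_meanCoord hx).differentiableAt (n := ∞) (by simp)
  have dG (i j) := (h.contDiffAt_firstForm hx i j).differentiableAt (n := ∞) (by simp)
  have dh (i j) := (h.contDiffAt_secondForm hx i j).differentiableAt (n := ∞) (by simp)
  have hev : (fun y => meanCoord X N y * (firstForm X y 0 0 * firstForm X y 1 1
        - firstForm X y 0 1 * firstForm X y 0 1)) =ᶠ[𝓝 x] fun y =>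
      firstForm X y 1 1 * secondForm X N 0 0 y - 2 * (firstForm X y 0 1 * secondForm X N 0 1 y)
        + firstForm X y 0 0 * secondForm X N 1 1 y := by
    filter_upwards [h.eventually_mem hx] with y hy
    rw [h.meanCoord_mul_det hy, mul_assoc]
  have hj := pd_congr (i := j) hev
  rw [pd_mul df (((dG 0 0).fun_mul (dG 1 1)).fun_sub ((dG 0 1).fun_mul (dG 0 1))),
    pd_sub ((dG 0 0).fun_mul (dG 1 1)) ((dG 0 1).fun_mul (dG 0 1)),
    pd_mul (dG 0 0) (dG 1 1), pd_mul (dG 0 1) (dG 0 1),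
    pd_add (((dG 1 1).fun_mul (dh 0 0)).fun_sub (((dG 0 1).fun_mul (dh 0 1)).const_mul 2))
      ((dG 0 0).fun_mul (dh 1 1)),
    pd_sub ((dG 1 1).fun_mul (dh 0 0)) (((dG 0 1).fun_mul (dh 0 1)).const_mul 2),
    pd_const_mul 2 ((dG 0 1).fun_mul (dh 0 1)),
    pd_mul (dG 1 1) (dh 0 0), pd_mul (dG 0 1) (dh 0 1), pd_mul (dG 0 0) (dh 1 1)] at hj
  have hcov (k l : Fin 2) : pd j (secondForm X N k l) x = covSecondForm X N j k l x
      + ∑ m, christoffel (firstForm X) m j k x * secondForm X N m l x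
      + ∑ m, christoffel (firstForm X) m j l x * secondForm X N k m x := by
    simp only [covSecondForm]; ring
  have hcc : covSecondForm X N j 1 0 x = covSecondForm X N j 0 1 x :=
    h.covSecondForm_comm hx j 1 0
  -- Codazzi turns the divergence into the trace of `∇_j h`.
  have hsum : ∑ i, ∑ k, (firstForm X x)⁻¹ i k * covSecondForm X N i k j x =
      ∑ i, ∑ k, (firstForm X x)⁻¹ i k * covSecondForm X N j i k x := by
    simp only [h.covSecondForm_symm hx _ _ j]
  simp only [h.pd_firstForm hx, hcov, Fin.sum_univ_two, firstForm_symm X x 1 0,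
    h.secondForm_symm hx 1 0] at hj
  rw [firstForm_det] at hd
  rw [hsum]
  simp only [Fin.sum_univ_two, matrix_inv_apply, firstForm_symm X x 1 0, hcc, Matrix.of_apply,
    Matrix.cons_val', Matrix.cons_val_zero, Matrix.cons_val_one, Matrix.cons_val_fin_one]
  refine mul_left_cancel₀ hd ?_
  have hinv := mul_inv_cancel₀ hd
  simp only [mul_add, ← mul_assoc, hinv]
  -- The factor of `hf` comes from `∂_j det g = 2 det g ∑ Γ^m_{jm}`.
  linear_combination (-1) * hj + 2 * (christoffel (firstForm X) 0 j 0 x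
    + christoffel (firstForm X) 1 j 1 x) * hf

/-- As `∇g = 0`, the covariant derivative of `S₂` is `-f df ⊗ g + 2 df ⊗ h + 2 f ∇h`. Contracting,
the first term gives `-f df` and, by `div h = df`, the last gives `2 f df`. -/
theorem divTensor_stressEnergy (hx : x ∈ U) (j : Fin 2) :
    divTensor (firstForm X) (stressEnergy (firstForm X) X) j x =
      meanCoord X N x * pd j (meanCoord X N) x
        + 2 * ∑ k, (∑ i, (firstForm X x)⁻¹ k i * pd i (meanCoord X N) x)
            * secondForm X N k j x := by
  have hd := h.det_ne_zero x hx
  have df := (h.contDiffAt_meanCoord hx).differentiableAt (n := ∞) (by simp)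
  have dG (i j) := (h.contDiffAt_firstForm hx i j).differentiableAt (n := ∞) (by simp)
  have dh (i j) := (h.contDiffAt_secondForm hx i j).differentiableAt (n := ∞) (by simp)
  have hS (i k : Fin 2) : pd i (stressEnergy (firstForm X) X k j) x =
      -(meanCoord X N x * pd i (meanCoord X N) x) * firstForm X x k j
      - (1 / 2) * meanCoord X N x ^ 2 * pd i (fun y => firstForm X y k j) x
      + 2 * pd i (meanCoord X N) x * secondForm X N k j x
      + 2 * meanCoord X N x * pd i (secondForm X N k j) x := by
    have hev : stressEnergy (firstForm X) X k j =ᶠ[𝓝 x] fun y =>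
        (-(1 / 2)) * (meanCoord X N y * meanCoord X N y * firstForm X y k j)
          + 2 * (meanCoord X N y * secondForm X N k j y) := by
      filter_upwards [h.eventually_mem hx] with y hy
      rw [h.stressEnergy_eq hy]; ring
    rw [pd_congr hev, pd_add (((df.fun_mul df).fun_mul (dG k j)).const_mul _)
      ((df.fun_mul (dh k j)).const_mul _), pd_const_mul _ ((df.fun_mul df).fun_mul (dG k j)),
      pd_const_mul _ (df.fun_mul (dh k j)), pd_mul (df.fun_mul df) (dG k j), pd_mul df df,
      pd_mul df (dh k j)]
    ring
  have hterm (i k : Fin 2) : pd i (stressEnergy (firstForm X) X k j) x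
      - ∑ m, christoffel (firstForm X) m i k x * stressEnergy (firstForm X) X m j x
      - ∑ m, christoffel (firstForm X) m i j x * stressEnergy (firstForm X) X k m x =
      -(meanCoord X N x * pd i (meanCoord X N) x) * firstForm X x k j
      + 2 * pd i (meanCoord X N) x * secondForm X N k j x
      + 2 * meanCoord X N x * covSecondForm X N i k j x := by
    rw [hS]
    simp only [h.stressEnergy_eq hx, h.pd_firstForm hx, covSecondForm, Fin.sum_univ_two,
      firstForm_symm X x j]
    ring
  have hdiv := h.div_secondForm hx j
  have hinv (i : Fin 2) : ∑ k, (firstForm X x)⁻¹ i k * firstForm X x k j =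
      (1 : Matrix (Fin 2) (Fin 2) ℝ) i j := by
    rw [← Matrix.nonsing_inv_mul _ (isUnit_iff_ne_zero.2 hd), Matrix.mul_apply]
  have hone : ∑ i, pd i (meanCoord X N) x * (1 : Matrix (Fin 2) (Fin 2) ℝ) i j =
      pd j (meanCoord X N) x := by
    simp [Matrix.one_apply]
  have hsi : (firstForm X x)⁻¹ 1 0 = (firstForm X x)⁻¹ 0 1 := by
    simp [matrix_inv_apply, firstForm_symm X x 1 0]
  simp only [divTensor, hterm]
  simp only [← hinv] at hone
  simp only [Fin.sum_univ_two, hsi] at *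
  linear_combination 2 * meanCoord X N x * hdiv - meanCoord X N x * hone

end IsPatch

/-! ### Biconservative patches -/

/-- A biconservative patch with `f > 0` and `∇f ≠ 0`, where `f` is the mean curvature. -/
structure IsBiconservativePatch (U : Set Plane) (X N : Plane → Space) : Prop
    extends IsPatch U X N where
  divTensor_eq_zero : ∀ y ∈ U, ∀ j,
    divTensor (firstForm X) (stressEnergy (firstForm X) X) j y = 0
  mean_pos : ∀ y ∈ U, 0 < meanCoord X N y
  exists_pd_ne_zero : ∀ y ∈ U, ∃ i, pd i (meanCoord X N) y ≠ 0

/-- The components of the gradient of the mean curvature. -/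
def gradComp (X N : Plane → Space) (k : Fin 2) (x : Plane) : ℝ :=
  ∑ i, (firstForm X x)⁻¹ k i * pd i (meanCoord X N) x

/-- The image `dX(∇f)` of the gradient of the mean curvature. -/
def gradVec (X N : Plane → Space) (x : Plane) : Space :=
  gradComp X N 0 x • pd 0 X x + gradComp X N 1 x • pd 1 X x

/-- A tangent vector field orthogonal to the gradient of the mean curvature. -/
def orthVec (X N : Plane → Space) (x : Plane) : Space :=
  pd 0 (meanCoord X N) x • pd 1 X x - pd 1 (meanCoord X N) x • pd 0 X x

/-- The unit vector field in the direction of the gradient of the mean curvature. -/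
def gradDir (X N : Plane → Space) (x : Plane) : Space := ‖gradVec X N x‖⁻¹ • gradVec X N x

/-- The unit tangent vector field orthogonal to the gradient of the mean curvature. -/
def orthDir (X N : Plane → Space) (x : Plane) : Space := ‖orthVec X N x‖⁻¹ • orthVec X N x

/-! ### Principal curvatures and the principal frame -/

namespace IsBiconservativePatch

variable {U : Set Plane} {X N : Plane → Space} (h : IsBiconservativePatch U X N) {x : Plane}
include h

theorem sum_firstForm_mul_gradComp (hx : x ∈ U) (j : Fin 2) :
    firstForm X x j 0 * gradComp X N 0 x + firstForm X x j 1 * gradComp X N 1 x =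
      pd j (meanCoord X N) x := by
  have h1 : firstForm X x * (firstForm X x)⁻¹ = 1 :=
    Matrix.mul_nonsing_inv _ (isUnit_iff_ne_zero.2 (h.det_ne_zero x hx))
  have : (firstForm X x).mulVec ((firstForm X x)⁻¹.mulVec fun i => pd i (meanCoord X N) x) j =
      pd j (meanCoord X N) x := by
    rw [Matrix.mulVec_mulVec, h1, Matrix.one_mulVec]
  simpa [Matrix.mulVec, dotProduct, gradComp, Fin.sum_univ_two] using this

/-- The gradient of `f` is an eigenvector of the shape operator for the eigenvalue `-f/2`. -/
theorem eigen (hx : x ∈ U) (j : Fin 2) :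
    gradComp X N 0 x * secondForm X N 0 j x + gradComp X N 1 x * secondForm X N 1 j x =
      -(meanCoord X N x / 2) * pd j (meanCoord X N) x := by
  have h1 := h.divTensor_stressEnergy hx j
  rw [h.divTensor_eq_zero x hx, Fin.sum_univ_two] at h1
  simp only [← gradComp.eq_1 X N] at h1
  linarith

theorem exists_gradComp_ne_zero (hx : x ∈ U) : ∃ k, gradComp X N k x ≠ 0 := by
  by_contra! hk
  obtain ⟨i, hi⟩ := h.exists_pd_ne_zero x hx
  rw [← h.sum_firstForm_mul_gradComp hx, hk, hk] at hi
  simp at hi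

/-- The shape operator has trace `f` and an eigenvalue `-f/2`, so the other is `3f/2`; the curvature
is their product. -/
theorem gaussCoord_eq (hx : x ∈ U) :
    gaussCoord (firstForm X) x = -(3 / 4) * meanCoord X N x ^ 2 := by
  have hd := h.det_ne_zero x hx
  have hK := h.det_mul_gaussCoord hx
  have hf := h.meanCoord_mul_det hx
  have hs := h.secondForm_symm hx 1 0
  have hg := firstForm_symm X x 1 0
  have e0 := h.eigen hx 0
  have e1 := h.eigen hx 1
  rw [← h.sum_firstForm_mul_gradComp hx] at e0 e1
  rw [hs] at e0
  rw [hg] at e1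
  refine mul_left_cancel₀ hd ?_
  rw [hK]
  rw [firstForm_det]
  generalize firstForm X x 0 0 = E at *
  generalize firstForm X x 0 1 = F at *
  generalize firstForm X x 1 1 = H at *
  generalize meanCoord X N x = f at *
  generalize secondForm X N 0 0 x = a at *
  generalize secondForm X N 0 1 x = b at *
  generalize secondForm X N 1 1 x = c at *
  -- The form `h + (f/2) g` is degenerate because `∇f ≠ 0` lies in its kernel. Expanding its
  -- determinant and inserting the trace relation `hf` gives `det h = -(3/4) f² det g`.
  have key : (a + f / 2 * E) * (c + f / 2 * H) - (b + f / 2 * F) ^ 2 = 0 := by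
    obtain ⟨k, hk⟩ := h.exists_gradComp_ne_zero hx
    refine (mul_eq_zero.1 (?_ : gradComp X N k x * _ = 0)).resolve_left hk
    fin_cases k
    · simp only [Fin.zero_eta]
      linear_combination (c + f / 2 * H) * e0 - (b + f / 2 * F) * e1
    · simp only [Fin.mk_one]
      linear_combination (a + f / 2 * E) * e1 - (b + f / 2 * F) * e0
  linear_combination key + f / 2 * hf

theorem inner_pd_gradVec (hx : x ∈ U) (j : Fin 2) :
    inner ℝ (pd j X x) (gradVec X N x) = pd j (meanCoord X N) x := by
  rw [← h.sum_firstForm_mul_gradComp hx, gradVec, inner_add_right, inner_smul_right,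
    inner_smul_right, firstForm_apply, firstForm_apply]
  ring

theorem inner_pd_normal_gradVec (hx : x ∈ U) (j : Fin 2) :
    inner ℝ (pd j N x) (gradVec X N x) = meanCoord X N x / 2 * pd j (meanCoord X N) x := by
  have := h.eigen hx j
  rw [gradVec, inner_add_right, inner_smul_right, inner_smul_right, real_inner_comm,
    h.inner_pd_normal hx, real_inner_comm, h.inner_pd_normal hx, h.secondForm_symm hx j,
    h.secondForm_symm hx j]
  linarith

/-- The direction orthogonal to `∇f` is principal for the remaining eigenvalue `f - (-f/2) = 3f/2`,
and `dN = -A`. In the computation `e0`, `e1` are the eigenvector equation, `hf` is the trace, and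
`g0`, `g1` express `df` through `∇f`. -/
theorem inner_pd_normal_orthVec (hx : x ∈ U) (j : Fin 2) :
    inner ℝ (pd j N x) (orthVec X N x) =
      -(3 / 2 * meanCoord X N x) * inner ℝ (pd j X x) (orthVec X N x) := by
  have e0 := h.eigen hx 0
  have e1 := h.eigen hx 1
  have hf := h.meanCoord_mul_det hx
  have g0 := h.sum_firstForm_mul_gradComp hx 0
  have g1 := h.sum_firstForm_mul_gradComp hx 1
  have hs := h.secondForm_symm hx 1 0
  have hg := firstForm_symm X x 1 0
  rw [hs] at e0
  rw [hg] at g1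
  rw [orthVec, inner_sub_right, inner_smul_right, inner_smul_right, real_inner_comm,
    h.inner_pd_normal hx, real_inner_comm, h.inner_pd_normal hx, inner_sub_right,
    inner_smul_right, inner_smul_right, ← firstForm_apply, ← firstForm_apply]
  generalize pd 0 (meanCoord X N) x = f0 at *
  generalize pd 1 (meanCoord X N) x = f1 at *
  fin_cases j
  · simp only [Fin.zero_eta]
    generalize firstForm X x 0 0 = E at *
    generalize firstForm X x 0 1 = F at *
    generalize firstForm X x 1 1 = H at *
    generalize secondForm X N 0 0 x = a at *
    generalize secondForm X N 0 1 x = b at *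
    generalize secondForm X N 1 1 x = c at *
    generalize gradComp X N 0 x = v at *
    generalize gradComp X N 1 x = w at *
    generalize meanCoord X N x = f at *
    linear_combination F * e0 - E * e1 - w * hf + b * g0 - a * g1 + f * E * g1 - f * F * g0
  · simp only [Fin.mk_one, hs, hg]
    generalize firstForm X x 0 0 = E at *
    generalize firstForm X x 0 1 = F at *
    generalize firstForm X x 1 1 = H at *
    generalize secondForm X N 0 0 x = a at *
    generalize secondForm X N 0 1 x = b at *
    generalize secondForm X N 1 1 x = c at *
    generalize gradComp X N 0 x = v at *
    generalize gradComp X N 1 x = w at *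
    generalize meanCoord X N x = f at *
    linear_combination H * e0 - F * e1 + v * hf + c * g0 - b * g1 + f * F * g1 - f * H * g0

theorem gradVec_ne_zero (hx : x ∈ U) : gradVec X N x ≠ 0 := fun h0 => by
  obtain ⟨i, hi⟩ := h.exists_pd_ne_zero x hx
  rw [← h.inner_pd_gradVec hx, h0, inner_zero_right] at hi
  exact hi rfl

theorem orthVec_ne_zero (hx : x ∈ U) : orthVec X N x ≠ 0 := fun h0 => by
  have hd := h.det_ne_zero x hx
  rw [firstForm_det] at hd
  have e (j : Fin 2) : pd 0 (meanCoord X N) x * firstForm X x j 1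
      - pd 1 (meanCoord X N) x * firstForm X x j 0 = 0 := by
    have : inner ℝ (pd j X x) (orthVec X N x) = (0 : ℝ) := by rw [h0, inner_zero_right]
    rwa [orthVec, inner_sub_right, inner_smul_right, inner_smul_right] at this
  have e0 := e 0
  have e1 := e 1
  rw [firstForm_symm X x 1 0] at e1
  obtain ⟨i, hi⟩ := h.exists_pd_ne_zero x hx
  refine hi ((mul_eq_zero.1 (?_ : (firstForm X x 0 0 * firstForm X x 1 1
    - firstForm X x 0 1 * firstForm X x 0 1) * _ = 0)).resolve_left hd)
  fin_cases i
  · simp only [Fin.zero_eta]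
    linear_combination firstForm X x 0 0 * e1 - firstForm X x 0 1 * e0
  · simp only [Fin.mk_one]
    linear_combination firstForm X x 0 1 * e1 - firstForm X x 1 1 * e0

theorem inner_gradVec_orthVec (hx : x ∈ U) : inner ℝ (gradVec X N x) (orthVec X N x) = (0 : ℝ) := by
  rw [orthVec, inner_sub_right, inner_smul_right, inner_smul_right, real_inner_comm,
    h.inner_pd_gradVec hx, real_inner_comm, h.inner_pd_gradVec hx]
  ring

theorem gradDir_inner_self (hx : x ∈ U) : inner ℝ (gradDir X N x) (gradDir X N x) = (1 : ℝ) := by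
  rw [real_inner_self_eq_norm_sq, gradDir, norm_smul, norm_inv, norm_norm,
    inv_mul_cancel₀ (norm_ne_zero_iff.2 (h.gradVec_ne_zero hx)), one_pow]

theorem orthDir_inner_self (hx : x ∈ U) : inner ℝ (orthDir X N x) (orthDir X N x) = (1 : ℝ) := by
  rw [real_inner_self_eq_norm_sq, orthDir, norm_smul, norm_inv, norm_norm,
    inv_mul_cancel₀ (norm_ne_zero_iff.2 (h.orthVec_ne_zero hx)), one_pow]

theorem inner_gradDir_orthDir (hx : x ∈ U) : inner ℝ (gradDir X N x) (orthDir X N x) = (0 : ℝ) := by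
  rw [gradDir, orthDir, real_inner_smul_left, inner_smul_right, h.inner_gradVec_orthVec hx]
  simp

theorem inner_normal_gradDir (hx : x ∈ U) : inner ℝ (gradDir X N x) (N x) = (0 : ℝ) := by
  rw [gradDir, gradVec, real_inner_smul_left, inner_add_left, real_inner_smul_left,
    real_inner_smul_left, h.inner_normal x hx, h.inner_normal x hx]
  simp

theorem inner_normal_orthDir (hx : x ∈ U) : inner ℝ (orthDir X N x) (N x) = (0 : ℝ) := by
  rw [orthDir, orthVec, real_inner_smul_left, inner_sub_left, real_inner_smul_left,
    real_inner_smul_left, h.inner_normal x hx, h.inner_normal x hx]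
  simp

theorem contDiffAt_pd_meanCoord (hx : x ∈ U) (i : Fin 2) :
    ContDiffAt ℝ ∞ (pd i (meanCoord X N)) x :=
  contDiffAt_pd (h.contDiffAt_meanCoord hx)

theorem contDiffAt_gradDir (hx : x ∈ U) : ContDiffAt ℝ ∞ (gradDir X N) x := by
  have hc (k : Fin 2) : ContDiffAt ℝ ∞ (gradComp X N k) x :=
    ContDiffAt.sum fun i _ => (contDiffAt_inv (h.contDiffAt_firstForm hx)
      (h.det_ne_zero x hx) k i).mul (h.contDiffAt_pd_meanCoord hx i)
  have hV : ContDiffAt ℝ ∞ (gradVec X N) x :=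
    ((hc 0).smul (h.contDiffAt_pd_coord hx 0)).add ((hc 1).smul (h.contDiffAt_pd_coord hx 1))
  exact ((hV.norm ℝ (h.gradVec_ne_zero hx)).inv
    (norm_ne_zero_iff.2 (h.gradVec_ne_zero hx))).smul hV

theorem contDiffAt_orthDir (hx : x ∈ U) : ContDiffAt ℝ ∞ (orthDir X N) x := by
  have hV : ContDiffAt ℝ ∞ (orthVec X N) x :=
    ((h.contDiffAt_pd_meanCoord hx 0).smul (h.contDiffAt_pd_coord hx 1)).sub
      ((h.contDiffAt_pd_meanCoord hx 1).smul (h.contDiffAt_pd_coord hx 0))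
  exact ((hV.norm ℝ (h.orthVec_ne_zero hx)).inv
    (norm_ne_zero_iff.2 (h.orthVec_ne_zero hx))).smul hV

theorem eq_frame (hx : x ∈ U) {R : Space} (hR : inner ℝ R (N x) = 0) :
    R = (inner ℝ R (gradDir X N x) : ℝ) • gradDir X N x
      + (inner ℝ R (orthDir X N x) : ℝ) • orthDir X N x := by
  have h1 := h.gradDir_inner_self hx
  have h2 := h.orthDir_inner_self hx
  have h3 := h.inner_gradDir_orthDir hx
  have h3' := h3
  rw [real_inner_comm] at h3'
  have h4 := h.inner_normal_gradDir hx
  have h5 := h.inner_normal_orthDir hx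
  rw [← sub_eq_zero]
  refine eq_zero_of_inner_eq_zero (u := ![gradDir X N x, orthDir X N x]) (n := N x) ?_
    (h.norm_normal x hx) ?_ ?_ ?_
  · rw [Matrix.det_fin_two]; simp only [Matrix.of_apply, Matrix.cons_val_zero,
      Matrix.cons_val_one, Matrix.cons_val_fin_one, h1, h2, h3]; norm_num
  · intro i; fin_cases i <;> simp [h4, h5]
  · intro i
    fin_cases i
    · simp only [Fin.zero_eta, Matrix.cons_val_zero, inner_sub_right, inner_add_right,
        inner_smul_right, h1, h3, real_inner_comm R]
      ring
    · simp only [Fin.mk_one, Matrix.cons_val_one, Matrix.cons_val_fin_one, inner_sub_right,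
        inner_add_right, inner_smul_right, h2, h3', real_inner_comm R]
      ring
  · rw [real_inner_comm] at hR h4 h5
    simp [inner_sub_right, inner_add_right, inner_smul_right, hR, h4, h5]

end IsBiconservativePatch

/-- The component of `∂_i X` in the direction of the gradient of the mean curvature. -/
def gradForm (X N : Plane → Space) (i : Fin 2) (x : Plane) : ℝ :=
  inner ℝ (pd i X x) (gradDir X N x)

/-- The component of `∂_i X` orthogonal to the gradient of the mean curvature. -/
def orthForm (X N : Plane → Space) (i : Fin 2) (x : Plane) : ℝ :=
  inner ℝ (pd i X x) (orthDir X N x)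

/-- The flat coframe `f^{3/4} θ`, with values in the plane spanned by the first two coordinate
vectors of `ℝ³`. -/
def flatCoframe (X N : Plane → Space) (i : Fin 2) (x : Plane) : Space :=
  (meanCoord X N x ^ (3 / 4 : ℝ) * gradForm X N i x) • EuclideanSpace.single 0 1
    + (meanCoord X N x ^ (3 / 4 : ℝ) * orthForm X N i x) • EuclideanSpace.single 1 1

theorem pd_smul_add_smul {V : Type*} [NormedAddCommGroup V] [NormedSpace ℝ V] {x : Plane}
    {a b : Plane → ℝ} {F H : Plane → V} (ha : DifferentiableAt ℝ a x)
    (hb : DifferentiableAt ℝ b x) (hF : DifferentiableAt ℝ F x) (hH : DifferentiableAt ℝ H x)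
    (i : Fin 2) : pd i (fun y => a y • F y + b y • H y) x =
      (a x • pd i F x + pd i a x • F x) + (b x • pd i H x + pd i b x • H x) := by
  rw [pd_add (ha.fun_smul hF) (hb.fun_smul hH), pd_smul ha hF, pd_smul hb hH]

/-! ### Structure equations, the flat metric and its conformal multiples -/

namespace IsBiconservativePatch

variable {U : Set Plane} {X N : Plane → Space} (h : IsBiconservativePatch U X N) {x : Plane}
include h

theorem contDiffAt_gradForm (hx : x ∈ U) (i : Fin 2) : ContDiffAt ℝ ∞ (gradForm X N i) x :=
  (h.contDiffAt_pd_coord hx i).inner ℝ (h.contDiffAt_gradDir hx)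

theorem contDiffAt_orthForm (hx : x ∈ U) (i : Fin 2) : ContDiffAt ℝ ∞ (orthForm X N i) x :=
  (h.contDiffAt_pd_coord hx i).inner ℝ (h.contDiffAt_orthDir hx)

theorem pd_eq_frame (hx : x ∈ U) (i : Fin 2) :
    pd i X x = gradForm X N i x • gradDir X N x + orthForm X N i x • orthDir X N x :=
  h.eq_frame hx (h.inner_normal x hx i)

/-- The shape operator is diagonal in the frame with entries `-f/2` and `3f/2`. -/
theorem pd_normal_eq_frame (hx : x ∈ U) (i : Fin 2) :
    pd i N x = (1 / 2 * (meanCoord X N x * gradForm X N i x)) • gradDir X N x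
      + (-(3 / 2) * (meanCoord X N x * orthForm X N i x)) • orthDir X N x := by
  have e1 : inner ℝ (pd i N x) (gradDir X N x) =
      1 / 2 * (meanCoord X N x * gradForm X N i x) := by
    rw [gradForm, gradDir, inner_smul_right, inner_smul_right, h.inner_pd_normal_gradVec hx,
      h.inner_pd_gradVec hx]
    ring
  have e2 : inner ℝ (pd i N x) (orthDir X N x) =
      -(3 / 2) * (meanCoord X N x * orthForm X N i x) := by
    rw [orthForm, orthDir, inner_smul_right, inner_smul_right, h.inner_pd_normal_orthVec hx]
    ring
  rw [← e1, ← e2]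
  refine h.eq_frame hx ?_
  rw [real_inner_comm]
  exact h.normal_inner_pd_normal hx i

theorem inner_pd_gradDir_self (hx : x ∈ U) (i : Fin 2) :
    inner ℝ (pd i (gradDir X N) x) (gradDir X N x) = (0 : ℝ) := by
  have hev : (fun y => (inner ℝ (gradDir X N y) (gradDir X N y) : ℝ)) =ᶠ[𝓝 x] fun _ => 1 := by
    filter_upwards [h.eventually_mem hx] with y hy using h.gradDir_inner_self hy
  have d := (h.contDiffAt_gradDir hx).differentiableAt (n := ∞) (by simp)
  have := pd_congr (i := i) hev
  rw [pd_const, pd_inner d d] at this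
  linarith [real_inner_comm (pd i (gradDir X N) x) (gradDir X N x)]

theorem inner_pd_orthDir_self (hx : x ∈ U) (i : Fin 2) :
    inner ℝ (pd i (orthDir X N) x) (orthDir X N x) = (0 : ℝ) := by
  have hev : (fun y => (inner ℝ (orthDir X N y) (orthDir X N y) : ℝ)) =ᶠ[𝓝 x] fun _ => 1 := by
    filter_upwards [h.eventually_mem hx] with y hy using h.orthDir_inner_self hy
  have d := (h.contDiffAt_orthDir hx).differentiableAt (n := ∞) (by simp)
  have := pd_congr (i := i) hev
  rw [pd_const, pd_inner d d] at this
  linarith [real_inner_comm (pd i (orthDir X N) x) (orthDir X N x)]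

theorem inner_pd_orthDir_gradDir (hx : x ∈ U) (i : Fin 2) :
    inner ℝ (pd i (orthDir X N) x) (gradDir X N x) =
      -inner ℝ (pd i (gradDir X N) x) (orthDir X N x) := by
  have hev : (fun y => (inner ℝ (gradDir X N y) (orthDir X N y) : ℝ)) =ᶠ[𝓝 x] fun _ => 0 := by
    filter_upwards [h.eventually_mem hx] with y hy using h.inner_gradDir_orthDir hy
  have := pd_congr (i := i) hev
  rw [pd_const, pd_inner ((h.contDiffAt_gradDir hx).differentiableAt (by simp))
    ((h.contDiffAt_orthDir hx).differentiableAt (by simp))] at this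
  linarith [real_inner_comm (pd i (orthDir X N) x) (gradDir X N x)]

/-- The compatibility condition for a map whose differential is `α e₁ + β e₂` in the moving
frame. -/
theorem frame_integrability (hx : x ∈ U) {Y : Plane → Space} (hY : ContDiffAt ℝ ∞ Y x)
    {α β : Fin 2 → Plane → ℝ} (hα : ∀ i, DifferentiableAt ℝ (α i) x)
    (hβ : ∀ i, DifferentiableAt ℝ (β i) x)
    (heq : ∀ y ∈ U, ∀ i, pd i Y y = α i y • gradDir X N y + β i y • orthDir X N y) :
    pd 0 (α 1) x - β 1 x * inner ℝ (pd 0 (gradDir X N) x) (orthDir X N x) =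
      pd 1 (α 0) x - β 0 x * inner ℝ (pd 1 (gradDir X N) x) (orthDir X N x) ∧
    pd 0 (β 1) x + α 1 x * inner ℝ (pd 0 (gradDir X N) x) (orthDir X N x) =
      pd 1 (β 0) x + α 0 x * inner ℝ (pd 1 (gradDir X N) x) (orthDir X N x) := by
  have d1 := (h.contDiffAt_gradDir hx).differentiableAt (n := ∞) (by simp)
  have d2 := (h.contDiffAt_orthDir hx).differentiableAt (n := ∞) (by simp)
  have hpd (i j : Fin 2) : pd i (pd j Y) x =
      (α j x • pd i (gradDir X N) x + pd i (α j) x • gradDir X N x)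
        + (β j x • pd i (orthDir X N) x + pd i (β j) x • orthDir X N x) := by
    have hev : pd j Y =ᶠ[𝓝 x] fun y => α j y • gradDir X N y + β j y • orthDir X N y := by
      filter_upwards [h.eventually_mem hx] with y hy using heq y hy j
    rw [pd_congr hev, pd_smul_add_smul (hα j) (hβ j) d1 d2]
  -- The two claims are the `e₁` and `e₂` components of equality of mixed partials; `⟨∂_i e₁, e₂⟩`
  -- is the connection form.
  have hc := pd_pd_comm (i := 0) (j := 1) hY
  rw [hpd, hpd] at hc
  have c1 := congrArg (fun v => (inner ℝ v (gradDir X N x) : ℝ)) hc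
  have c2 := congrArg (fun v => (inner ℝ v (orthDir X N x) : ℝ)) hc
  have hog : inner ℝ (orthDir X N x) (gradDir X N x) = (0 : ℝ) := by
    rw [real_inner_comm]; exact h.inner_gradDir_orthDir hx
  simp only [inner_add_left, real_inner_smul_left, h.inner_pd_gradDir_self hx,
    h.inner_pd_orthDir_self hx, h.inner_pd_orthDir_gradDir hx, h.gradDir_inner_self hx,
    h.orthDir_inner_self hx, h.inner_gradDir_orthDir hx, hog] at c1 c2
  constructor <;> linarith

/-- This is `df ∧ θ₁ = 0`, true because `df = |∇f| θ₁`. -/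
theorem pd_mean_mul_gradForm (hx : x ∈ U) : pd 0 (meanCoord X N) x * gradForm X N 1 x =
    pd 1 (meanCoord X N) x * gradForm X N 0 x := by
  simp only [gradForm, gradDir, inner_smul_right, h.inner_pd_gradVec hx]
  ring

/-- The differentials of the dual coframe. -/
theorem coframe_equations (hx : x ∈ U) :
    pd 0 (gradForm X N 1) x = pd 1 (gradForm X N 0) x ∧
    4 * meanCoord X N x * (pd 0 (orthForm X N 1) x - pd 1 (orthForm X N 0) x) =
      -3 * (pd 0 (meanCoord X N) x * orthForm X N 1 x
        - pd 1 (meanCoord X N) x * orthForm X N 0 x) := by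
  have dα (i) := (h.contDiffAt_gradForm hx i).differentiableAt (n := ∞) (by simp)
  have dβ (i) := (h.contDiffAt_orthForm hx i).differentiableAt (n := ∞) (by simp)
  have df := (h.contDiffAt_meanCoord hx).differentiableAt (n := ∞) (by simp)
  obtain ⟨a1, a2⟩ := h.frame_integrability hx (h.contDiffAt x hx) dα dβ
    fun y hy i => h.pd_eq_frame hy i
  obtain ⟨b1, b2⟩ := h.frame_integrability hx (h.contDiffAt_normal x hx)
    (α := fun i y => 1 / 2 * (meanCoord X N y * gradForm X N i y))
    (β := fun i y => -(3 / 2) * (meanCoord X N y * orthForm X N i y))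
    (fun i => (df.fun_mul (dα i)).const_mul _) (fun i => (df.fun_mul (dβ i)).const_mul _)
    fun y hy i => h.pd_normal_eq_frame hy i
  rw [pd_const_mul _ (df.fun_mul (dα 1)), pd_const_mul _ (df.fun_mul (dα 0)), pd_mul df (dα 1),
    pd_mul df (dα 0)] at b1
  rw [pd_const_mul _ (df.fun_mul (dβ 1)), pd_const_mul _ (df.fun_mul (dβ 0)), pd_mul df (dβ 1),
    pd_mul df (dβ 0)] at b2
  have hpar := h.pd_mean_mul_gradForm hx
  have hf := h.mean_pos x hx
  -- The `a`'s come from `X` and the `b`'s from `N`; as the principal curvatures differ, the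
  -- combinations below eliminate the connection form. Positivity of `f` allows the division in the
  -- first part.
  constructor
  · have : meanCoord X N x * (pd 0 (gradForm X N 1) x - pd 1 (gradForm X N 0) x) = 0 := by
      linear_combination 1 / 2 * b1 + 3 / 4 * meanCoord X N x * a1 - 1 / 4 * hpar
    exact sub_eq_zero.1 ((mul_eq_zero.1 this).resolve_left hf.ne')
  · linear_combination (-2) * b2 + meanCoord X N x * a2

theorem contDiffAt_rpow (hx : x ∈ U) (s : ℝ) :
    ContDiffAt ℝ ∞ (fun y => meanCoord X N y ^ s) x :=
  (h.contDiffAt_meanCoord hx).rpow_const_of_ne (h.mean_pos x hx).ne'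

theorem contDiffAt_flatCoframe (hx : x ∈ U) (i : Fin 2) :
    ContDiffAt ℝ ∞ (flatCoframe X N i) x :=
  (((h.contDiffAt_rpow hx _).mul (h.contDiffAt_gradForm hx i)).smul contDiffAt_const).add
    (((h.contDiffAt_rpow hx _).mul (h.contDiffAt_orthForm hx i)).smul contDiffAt_const)

theorem pd_rpow_mul (hx : x ∈ U) {a : Plane → ℝ} (ha : DifferentiableAt ℝ a x) (i : Fin 2) :
    pd i (fun y => meanCoord X N y ^ (3 / 4 : ℝ) * a y) x =
      meanCoord X N x ^ (3 / 4 : ℝ) / meanCoord X N x *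
        (meanCoord X N x * pd i a x + 3 / 4 * pd i (meanCoord X N) x * a x) := by
  have hf := h.mean_pos x hx
  have df := (h.contDiffAt_meanCoord hx).differentiableAt (n := ∞) (by simp)
  rw [pd_mul ((h.contDiffAt_rpow hx _).differentiableAt (by simp)) ha,
    pd_comp (Real.hasDerivAt_rpow_const (Or.inl hf.ne')) df, Real.rpow_sub_one hf.ne']
  field_simp

theorem pd_flatCoframe (hx : x ∈ U) (i j : Fin 2) : pd i (flatCoframe X N j) x =
    pd i (fun y => meanCoord X N y ^ (3 / 4 : ℝ) * gradForm X N j y) x •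
      EuclideanSpace.single 0 1
    + pd i (fun y => meanCoord X N y ^ (3 / 4 : ℝ) * orthForm X N j y) x •
      EuclideanSpace.single 1 1 := by
  have d1 := ((h.contDiffAt_rpow hx (3 / 4)).mul (h.contDiffAt_gradForm hx j)).differentiableAt
    (n := ∞) (by simp)
  have d2 := ((h.contDiffAt_rpow hx (3 / 4)).mul (h.contDiffAt_orthForm hx j)).differentiableAt
    (n := ∞) (by simp)
  have := pd_smul_add_smul (V := Space) (i := i) d1 d2
    (differentiableAt_const (EuclideanSpace.single 0 1))
    (differentiableAt_const (EuclideanSpace.single 1 1))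
  rw [pd_const, pd_const, smul_zero, smul_zero, zero_add, zero_add] at this
  exact this

/-- The power `3/4` is the integrating factor for `dθ₂ = -(3/4) d(log f) ∧ θ₂`; `θ₁` tolerates any
power of `f`, since `df ∧ θ₁ = 0`. -/
theorem flatCoframe_closed (hx : x ∈ U) :
    pd 0 (flatCoframe X N 1) x = pd 1 (flatCoframe X N 0) x := by
  obtain ⟨c1, c2⟩ := h.coframe_equations hx
  have hpar := h.pd_mean_mul_gradForm hx
  have dα (i) := (h.contDiffAt_gradForm hx i).differentiableAt (n := ∞) (by simp)
  have dβ (i) := (h.contDiffAt_orthForm hx i).differentiableAt (n := ∞) (by simp)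
  rw [h.pd_flatCoframe hx, h.pd_flatCoframe hx, h.pd_rpow_mul hx (dα _), h.pd_rpow_mul hx (dα _),
    h.pd_rpow_mul hx (dβ _), h.pd_rpow_mul hx (dβ _)]
  congr 3
  · linear_combination meanCoord X N x * c1 + 3 / 4 * hpar
  · linear_combination 1 / 4 * c2

theorem gram_flatCoframe (hx : x ∈ U) :
    gram (flatCoframe X N) x = meanCoord X N x ^ (3 / 2 : ℝ) • firstForm X x := by
  have hf := h.mean_pos x hx
  have hsq : meanCoord X N x ^ (3 / 2 : ℝ) =
      meanCoord X N x ^ (3 / 4 : ℝ) * meanCoord X N x ^ (3 / 4 : ℝ) := by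
    rw [← Real.rpow_add hf]; norm_num
  have hog : inner ℝ (orthDir X N x) (gradDir X N x) = (0 : ℝ) := by
    rw [real_inner_comm]; exact h.inner_gradDir_orthDir hx
  ext i j
  rw [Matrix.smul_apply, firstForm_apply, gram_apply, h.pd_eq_frame hx i, h.pd_eq_frame hx j, hsq]
  simp only [flatCoframe, inner_add_left, inner_add_right, real_inner_smul_left, inner_smul_right,
    h.gradDir_inner_self hx, h.orthDir_inner_self hx, h.inner_gradDir_orthDir hx, hog,
    EuclideanSpace.inner_single_left, smul_eq_mul]
  simp
  ring

/-- The coframe is closed and takes values in a fixed plane, so its derivatives have no component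
along the third coordinate vector: the egregium applies with `h = 0`. -/
theorem gaussCoord_gram_flatCoframe (hx : x ∈ U) : gaussCoord (gram (flatCoframe X N)) x = 0 := by
  have hdet : (gram (flatCoframe X N) x).det ≠ 0 := by
    rw [h.gram_flatCoframe hx, Matrix.det_smul]
    exact mul_ne_zero (pow_ne_zero _ (Real.rpow_pos_of_pos (h.mean_pos x hx) _).ne')
      (h.det_ne_zero x hx)
  set n : Space := EuclideanSpace.single 2 1 with hn
  have hn1 : ‖n‖ = 1 := by simp [hn]
  have hTn (i) : inner ℝ (flatCoframe X N i x) n = (0 : ℝ) := by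
    simp [flatCoframe, inner_add_left, real_inner_smul_left, hn, EuclideanSpace.inner_single_left]
  have hpn (i j) : inner ℝ n (pd i (flatCoframe X N j) x) = (0 : ℝ) := by
    rw [h.pd_flatCoframe hx]
    simp [inner_add_right, inner_smul_right, hn, EuclideanSpace.inner_single_left]
  have key := gram_det_mul_gaussCoord (h.contDiffAt_flatCoframe hx)
    (by filter_upwards [h.eventually_mem hx] with y hy using h.flatCoframe_closed hy)
    hdet hn1 hTn (h := fun _ _ => 0) (a := fun k i j => ∑ l, (gram (flatCoframe X N) x)⁻¹ k l *
      inner ℝ (flatCoframe X N l x) (pd i (flatCoframe X N j) x)) (fun i j => by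
        have := eq_sum_smul_add_smul hdet hn1 hTn (pd i (flatCoframe X N j) x)
        rwa [hpn] at this)
  simpa [hdet] using key

theorem gaussCoord_rpow_smul_eq_laplacian (hx : x ∈ U) {c : ℝ} (hc : 0 < c) (s : ℝ) :
    c * meanCoord X N x ^ s * gaussCoord (fun y => (c * meanCoord X N y ^ s) • firstForm X y) x =
      gaussCoord (firstForm X) x
        - s / 2 * laplacian (firstForm X) (fun y => Real.log (meanCoord X N y)) x := by
  have hlog : ContDiffAt ℝ ∞ (fun y => Real.log (meanCoord X N y)) x :=
    (h.contDiffAt_meanCoord hx).log (h.mean_pos x hx).ne'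
  have hexp {y} (hy : y ∈ U) : Real.exp (2 * (s / 2 * Real.log (meanCoord X N y)
      + Real.log c / 2)) = c * meanCoord X N y ^ s := by
    rw [Real.rpow_def_of_pos (h.mean_pos y hy)]
    nth_rewrite 2 [← Real.exp_log hc]
    rw [← Real.exp_add]
    congr 1
    ring
  have hconf := exp_mul_gaussCoord_conformal (h.contDiffAt_firstForm hx) (firstForm_symm X)
    (h.det_ne_zero x hx) ((contDiffAt_const (c := s / 2)).mul hlog |>.add
      (contDiffAt_const (c := Real.log c / 2)))
  rw [laplacian_const_mul_add hlog, hexp hx] at hconf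
  rw [← hconf]
  congr 1
  refine gaussCoord_congr ?_
  filter_upwards [h.eventually_mem hx] with y hy
  rw [hexp hy]

/-- Flatness of `f^{3/2} g`, read backwards through the conformal formula with `s = 3/2`. -/
theorem laplacian_log (hx : x ∈ U) :
    laplacian (firstForm X) (fun y => Real.log (meanCoord X N y)) x =
      4 / 3 * gaussCoord (firstForm X) x := by
  have h1 := h.gaussCoord_rpow_smul_eq_laplacian hx one_pos (3 / 2)
  have h2 : gaussCoord (fun y => (1 * meanCoord X N y ^ (3 / 2 : ℝ)) • firstForm X y) x = 0 := by
    rw [← h.gaussCoord_gram_flatCoframe hx]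
    refine gaussCoord_congr ?_
    filter_upwards [h.eventually_mem hx] with y hy
    rw [h.gram_flatCoframe hy, one_mul]
  rw [h2] at h1
  linarith

/-- The Gaussian curvature of the metric `c f^s g`. -/
theorem gaussCoord_rpow_smul (hx : x ∈ U) {c : ℝ} (hc : 0 < c) (s : ℝ) :
    c * meanCoord X N x ^ s * gaussCoord (fun y => (c * meanCoord X N y ^ s) • firstForm X y) x =
      (s / 2 - 3 / 4) * meanCoord X N x ^ 2 := by
  rw [h.gaussCoord_rpow_smul_eq_laplacian hx hc, h.laplacian_log hx, h.gaussCoord_eq hx]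
  ring

end IsBiconservativePatch

/-! ### Dependence on the metric near a point -/

section Congr

variable {G G' : Plane → Matrix (Fin 2) (Fin 2) ℝ} {x : Plane}

theorem tension_congr (h : G =ᶠ[𝓝 x] G') (X : Plane → Space) :
    tension G X =ᶠ[𝓝 x] tension G' X := by
  filter_upwards [h.eventuallyEq_nhds] with y hy
  have e (k i j : Fin 2) := (christoffel_congr hy k i j).eq_of_nhds
  simp only [tension, e, hy.eq_of_nhds]

theorem stressEnergy_congr (h : G =ᶠ[𝓝 x] G') (X : Plane → Space) (i j : Fin 2) :
    stressEnergy G X i j =ᶠ[𝓝 x] stressEnergy G' X i j := by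
  filter_upwards [h.eventuallyEq_nhds] with y hy
  have hτ := tension_congr hy X
  have e (k : Fin 2) : pd k (tension G X) y = pd k (tension G' X) y := pd_congr hτ
  simp only [stressEnergy, e, hτ.eq_of_nhds, hy.eq_of_nhds]

theorem divTensor_congr (h : G =ᶠ[𝓝 x] G') {S S' : Fin 2 → Fin 2 → Plane → ℝ}
    (hS : ∀ i j, S i j =ᶠ[𝓝 x] S' i j) (j : Fin 2) : divTensor G S j x = divTensor G' S' j x := by
  have e (k i j : Fin 2) := (christoffel_congr h k i j).eq_of_nhds
  have e' (i k j : Fin 2) : pd i (S k j) x = pd i (S' k j) x := pd_congr (hS k j)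
  have e'' (i j : Fin 2) := (hS i j).eq_of_nhds
  simp only [divTensor, e, e', e'', h.eq_of_nhds]

end Congr

/-! ### The trace of the shape operator -/

/-- The hypothesis `hc` puts the image of `D'` inside the range of `D`, so the arbitrary values of
`leftInverse` off that range play no role. -/
theorem trace_leftInverse_comp {D D' : Plane →ₗ[ℝ] Space} (hD : Function.Injective D)
    (b : Module.Basis (Fin 2) ℝ Plane) {c : Fin 2 → Fin 2 → ℝ}
    (hc : ∀ i, D' (b i) = ∑ k, c k i • D (b k)) :
    LinearMap.trace ℝ Plane (-(D.leftInverse ∘ₗ D')) = -∑ i, c i i := by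
  have hker : LinearMap.ker D = ⊥ := LinearMap.ker_eq_bot.2 hD
  have hA (i : Fin 2) : (D.leftInverse ∘ₗ D') (b i) = ∑ k, c k i • b k := by
    simp only [LinearMap.comp_apply, hc, map_sum, map_smul,
      LinearMap.leftInverse_apply_of_inj hker]
  rw [map_neg, LinearMap.trace_eq_matrix_trace ℝ b, Matrix.trace]
  congr 1
  refine Finset.sum_congr rfl fun i _ => ?_
  rw [Matrix.diag_apply, LinearMap.toMatrix_apply, hA, map_sum, Finsupp.coe_finsetSum,
    Finset.sum_apply]
  simp [Module.Basis.repr_self, Finsupp.single_apply]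

/-! ### Immersed surfaces in charts -/

section Surface

variable {M : Type*} [TopologicalSpace M] [ChartedSpace Plane M] [IsManifold (𝓡 2) ∞ M]
  {e : OpenPartialHomeomorph M Plane} {x : Plane}

theorem mdifferentiable_of_mem (he : e ∈ atlas Plane M) : e.MDifferentiable (𝓡 2) (𝓡 2) :=
  haveI : IsManifold (𝓡 2) 1 M := .of_le (n := ∞) (by exact mod_cast le_top)
  mdifferentiable_of_mem_atlas he

/-- The differential of the inverse of a chart. -/
def chartDeriv (e : OpenPartialHomeomorph M Plane) (x : Plane) : Plane →L[ℝ] Plane :=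
  mfderiv 𝓘(ℝ, Plane) (𝓡 2) e.symm x

theorem chartDeriv_injective (he : e ∈ atlas Plane M) (hx : x ∈ e.target) :
    Function.Injective (chartDeriv e x) :=
  (mdifferentiable_of_mem he).symm.mfderiv_injective hx

theorem chartDeriv_surjective (he : e ∈ atlas Plane M) (hx : x ∈ e.target) :
    Function.Surjective (chartDeriv e x) :=
  (mdifferentiable_of_mem he).symm.mfderiv_surjective hx

theorem fderiv_comp_symm {V : Type*} [NormedAddCommGroup V] [NormedSpace ℝ V]
    (he : e ∈ atlas Plane M) (hx : x ∈ e.target) {F : M → V}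
    (hF : MDifferentiableAt (𝓡 2) 𝓘(ℝ, V) F (e.symm x)) (v : Plane) :
    fderiv ℝ (fun y => F (e.symm y)) x v =
      (mfderiv (𝓡 2) 𝓘(ℝ, V) F (e.symm x) : Plane →L[ℝ] V) (chartDeriv e x v) := by
  have h1 := mfderiv_comp x hF ((mdifferentiable_of_mem he).symm.mdifferentiableAt hx)
  rw [mfderiv_eq_fderiv] at h1
  have := congrArg (fun L : Plane →L[ℝ] V => L v) h1
  exact this

theorem contDiffAt_comp_symm {V : Type*} [NormedAddCommGroup V] [NormedSpace ℝ V]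
    (he : e ∈ atlas Plane M) (hx : x ∈ e.target) {F : M → V}
    (hF : ContMDiff (𝓡 2) 𝓘(ℝ, V) ∞ F) : ContDiffAt ℝ ∞ (fun y => F (e.symm y)) x := by
  have h1 : ContMDiffAt (𝓡 2) (𝓡 2) ∞ e.symm x :=
    (contMDiffOn_symm_of_mem_maximalAtlas (IsManifold.subset_maximalAtlas he)).contMDiffAt
      (e.open_target.mem_nhds hx)
  exact (hF.contMDiffAt.comp x h1).contDiffAt

variable {ψ η : M → Space}

theorem pd_comp_symm (he : e ∈ atlas Plane M) (hx : x ∈ e.target) {F : M → Space}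
    (hF : ContMDiff (𝓡 2) 𝓘(ℝ, Space) ∞ F) (i : Fin 2) :
    pd i (fun y => F (e.symm y)) x =
      (differential F (e.symm x) : Plane →L[ℝ] Space)
        (chartDeriv e x (EuclideanSpace.single i 1)) :=
  fderiv_comp_symm he hx (hF.mdifferentiable (by simp) _) _

theorem metricInChart_inducedMetric (he : e ∈ atlas Plane M) (hx : x ∈ e.target)
    (hψ : IsSmoothImmersion ψ) :
    metricInChart (inducedMetric ψ) e x = firstForm (fun y => ψ (e.symm y)) x := by
  ext i j
  rw [firstForm_apply, pd_comp_symm he hx hψ.1, pd_comp_symm he hx hψ.1]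
  rfl

/-- A kernel vector of the Gram matrix gives a tangent vector whose image has length zero, against
injectivity of `dψ` and of the chart derivative. -/
theorem det_firstForm_ne_zero (he : e ∈ atlas Plane M) (hx : x ∈ e.target)
    (hψ : IsSmoothImmersion ψ) : (firstForm (fun y => ψ (e.symm y)) x).det ≠ 0 := by
  intro h0
  obtain ⟨v, hv, hv0⟩ := Matrix.exists_mulVec_eq_zero_iff.2 h0
  set X : Plane → Space := fun y => ψ (e.symm y)
  have hw : v 0 • pd 0 X x + v 1 • pd 1 X x = 0 := by
    have h1 (i : Fin 2) : inner ℝ (pd i X x) (v 0 • pd 0 X x + v 1 • pd 1 X x) = (0 : ℝ) := by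
      have := congrFun hv0 i
      simp only [Matrix.mulVec, dotProduct, Fin.sum_univ_two, firstForm_apply,
        Pi.zero_apply] at this
      rw [inner_add_right, inner_smul_right, inner_smul_right]
      linarith
    rw [← inner_self_eq_zero (𝕜 := ℝ)]
    conv_lhs => rw [inner_add_left, real_inner_smul_left, real_inner_smul_left, h1, h1]
    simp
  obtain ⟨D, hinj, hD⟩ : ∃ D : Plane →L[ℝ] Space, Function.Injective D ∧
      ∀ i, pd i X x = D (chartDeriv e x (EuclideanSpace.single i 1)) :=
    ⟨differential ψ (e.symm x), hψ.2 _, fun i => pd_comp_symm he hx hψ.1 i⟩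
  have h2 : D (chartDeriv e x
      (v 0 • EuclideanSpace.single 0 1 + v 1 • EuclideanSpace.single 1 1)) = 0 := by
    rw [map_add, map_smul, map_smul, map_add, map_smul, map_smul, ← hD, ← hD, hw]
  have h3 := chartDeriv_injective he hx
    ((hinj (h2.trans (map_zero _).symm)).trans (map_zero _).symm)
  apply hv
  ext i
  have := congrArg (fun w : Plane => w i) h3
  fin_cases i <;> simpa using this

theorem isPatch (he : e ∈ atlas Plane M) (hψ : IsSmoothImmersion ψ) (hη : IsUnitNormal ψ η) :
    IsPatch e.target (fun y => ψ (e.symm y)) (fun y => η (e.symm y)) where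
  isOpen := e.open_target
  contDiffAt _ hy := contDiffAt_comp_symm he hy hψ.1
  contDiffAt_normal _ hy := contDiffAt_comp_symm he hy hη.1
  norm_normal y _ := (hη.2 _).1
  inner_normal y hy i := by
    rw [pd_comp_symm he hy hψ.1, real_inner_comm]
    exact (hη.2 _).2 _
  det_ne_zero _ hy := det_firstForm_ne_zero he hy hψ

/-- The trace is taken in the coordinate basis, where the Weingarten equation gives the matrix of
`A`. -/
theorem meanCurvature_eq (he : e ∈ atlas Plane M) (hx : x ∈ e.target)
    (hψ : IsSmoothImmersion ψ) (hη : IsUnitNormal ψ η) :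
    meanCurvature ψ η (e.symm x) =
      meanCoord (fun y => ψ (e.symm y)) (fun y => η (e.symm y)) x := by
  have hp := isPatch he hψ hη
  set X : Plane → Space := fun y => ψ (e.symm y)
  set N : Plane → Space := fun y => η (e.symm y)
  let L : Plane ≃ₗ[ℝ] Plane := LinearEquiv.ofBijective (chartDeriv e x).toLinearMap
    ⟨chartDeriv_injective he hx, chartDeriv_surjective he hx⟩
  let b : Module.Basis (Fin 2) ℝ Plane := (EuclideanSpace.basisFun (Fin 2) ℝ).toBasis.map L
  have hb (i : Fin 2) : b i = chartDeriv e x (EuclideanSpace.single i 1) := by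
    simp only [b, L, Module.Basis.map_apply, OrthonormalBasis.coe_toBasis,
      EuclideanSpace.basisFun_apply]
    rfl
  have hc (i : Fin 2) : (differential η (e.symm x) : Plane →L[ℝ] Space).toLinearMap (b i) =
      ∑ k, (-∑ l, (firstForm X x)⁻¹ k l * secondForm X N i l x) •
        (differential ψ (e.symm x) : Plane →L[ℝ] Space).toLinearMap (b k) := by
    have h1 := eq_sum_smul_add_smul (hp.det_ne_zero x hx) (hp.norm_normal x hx)
      (hp.inner_normal x hx) (pd i N x)
    rw [hp.normal_inner_pd_normal hx, zero_smul, add_zero] at h1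
    simp only [hb, ContinuousLinearMap.coe_coe]
    rw [← pd_comp_symm he hx hη.1]
    refine h1.trans (Finset.sum_congr rfl fun k _ => ?_)
    rw [← pd_comp_symm he hx hψ.1]
    congr 1
    rw [← Finset.sum_neg_distrib]
    refine Finset.sum_congr rfl fun l _ => ?_
    rw [hp.inner_pd_normal hx, mul_neg]
  have htr := trace_leftInverse_comp
    (D := (differential ψ (e.symm x) : Plane →L[ℝ] Space).toLinearMap)
    (D' := (differential η (e.symm x) : Plane →L[ℝ] Space).toLinearMap)
    (hψ.2 (e.symm x)) b hc
  refine Eq.trans htr ?_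
  simp only [Finset.sum_neg_distrib, neg_neg, meanCoord]

theorem contMDiff_meanCurvature (hψ : IsSmoothImmersion ψ) (hη : IsUnitNormal ψ η) :
    ContMDiff (𝓡 2) 𝓘(ℝ, ℝ) ∞ (meanCurvature ψ η) := by
  intro p
  set e := chartAt Plane p
  have he : e ∈ atlas Plane M := chart_mem_atlas Plane p
  have hp : p ∈ e.source := mem_chart_source Plane p
  have h1 : ContMDiffAt (𝓡 2) (𝓡 2) ∞ e p :=
    (contMDiffOn_of_mem_maximalAtlas (IsManifold.subset_maximalAtlas he)).contMDiffAt
      (e.open_source.mem_nhds hp)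
  have h2 := ((isPatch he hψ hη).contDiffAt_meanCoord (e.map_source hp)).contMDiffAt
  refine (h2.comp p h1).congr_of_eventuallyEq ?_
  filter_upwards [e.open_source.mem_nhds hp] with q hq
  rw [Function.comp_apply, ← meanCurvature_eq he (e.map_source hq) hψ hη, e.left_inv hq]

/-- If all partial derivatives vanished, the zero vector would be a gradient of `f`, which `hgrad`
excludes. -/
theorem exists_pd_meanCoord_ne_zero (he : e ∈ atlas Plane M) (hx : x ∈ e.target)
    (hψ : IsSmoothImmersion ψ) (hη : IsUnitNormal ψ η)
    (hgrad : ∀ p v, IsGradientAt (inducedMetric ψ) (meanCurvature ψ η) p v → v ≠ 0) :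
    ∃ i, pd i (meanCoord (fun y => ψ (e.symm y)) (fun y => η (e.symm y))) x ≠ 0 := by
  by_contra! h0
  refine hgrad (e.symm x) 0 (fun w => ?_) rfl
  rw [map_zero]
  obtain ⟨v, hv⟩ := chartDeriv_surjective he hx w
  have hf : MDifferentiableAt (𝓡 2) 𝓘(ℝ, ℝ) (meanCurvature ψ η) (e.symm x) :=
    (contMDiff_meanCurvature hψ hη).mdifferentiable (by simp) _
  have h1 := fderiv_comp_symm he hx hf v
  rw [hv] at h1
  have hev : (fun y => meanCurvature ψ η (e.symm y)) =ᶠ[𝓝 x]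
      meanCoord (fun y => ψ (e.symm y)) (fun y => η (e.symm y)) := by
    filter_upwards [e.open_target.mem_nhds hx] with y hy using meanCurvature_eq he hy hψ hη
  rw [hev.fderiv_eq] at h1
  have hv2 : v = v 0 • EuclideanSpace.single 0 1 + v 1 • EuclideanSpace.single 1 1 := by
    ext i; fin_cases i <;> simp
  rw [hv2, map_add, map_smul, map_smul] at h1
  have h00 := h0 0
  have h01 := h0 1
  simp only [pd] at h00 h01
  rw [h00, h01] at h1
  simp only [smul_zero, add_zero] at h1
  exact h1

theorem isBiconservativePatch (he : e ∈ atlas Plane M) (hψ : IsSmoothImmersion ψ)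
    (hη : IsUnitNormal ψ η) (hbi : IsBiconservative ψ) (hf : ∀ p, 0 < meanCurvature ψ η p)
    (hgrad : ∀ p v, IsGradientAt (inducedMetric ψ) (meanCurvature ψ η) p v → v ≠ 0) :
    IsBiconservativePatch e.target (fun y => ψ (e.symm y)) (fun y => η (e.symm y)) where
  toIsPatch := isPatch he hψ hη
  divTensor_eq_zero y hy j := by
    have hev : metricInChart (inducedMetric ψ) e =ᶠ[𝓝 y] firstForm fun y => ψ (e.symm y) := by
      filter_upwards [e.open_target.mem_nhds hy] with z hz
      exact metricInChart_inducedMetric he hz hψ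
    rw [← hbi e he y hy j]
    exact (divTensor_congr hev (stressEnergy_congr hev _) j).symm
  mean_pos y hy := by
    rw [← meanCurvature_eq he hy hψ hη]; exact hf _
  exists_pd_ne_zero y hy := exists_pd_meanCoord_ne_zero he hy hψ hη hgrad

end Surface

/-! ### Conformal multiples of the induced metric on `M` -/

section Surface

variable {M : Type*} [TopologicalSpace M] [ChartedSpace Plane M]

/-- `ContMDiffRiemannianMetric` demands bounded unit balls. An injective linear map from a
finite-dimensional space is antilipschitz. -/
theorem isVonNBounded_of_pos {D : Plane →L[ℝ] Space} (hD : Function.Injective D) {c : ℝ}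
    (hc : 0 < c) : Bornology.IsVonNBounded ℝ {v : Plane | c * inner ℝ (D v) (D v) < 1} := by
  obtain ⟨K, hK, hanti⟩ := D.toLinearMap.exists_antilipschitzWith (LinearMap.ker_eq_bot.2 hD)
  refine (NormedSpace.isVonNBounded_closedBall ℝ Plane (K * (Real.sqrt c)⁻¹)).subset fun v hv => ?_
  have h1 : ‖v‖ ≤ K * ‖D v‖ := by simpa using hanti.le_mul_dist v 0
  have hv' : c * ‖D v‖ ^ 2 < 1 := by
    rw [← real_inner_self_eq_norm_sq]; exact hv
  have h2 : ‖D v‖ ≤ (Real.sqrt c)⁻¹ := by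
    rw [← Real.sqrt_inv]
    refine Real.le_sqrt_of_sq_le ?_
    rw [← one_div, le_div_iff₀ hc]
    linarith
  rw [mem_closedBall_zero_iff]
  exact h1.trans (mul_le_mul_of_nonneg_left h2 K.2)

/-- The pullback of the inner product of `ℝ³` by a linear map. -/
def pullbackInner (D : Plane →L[ℝ] Space) : Plane →L[ℝ] Plane →L[ℝ] ℝ :=
  (innerSL ℝ (E := Space) : Space →L[ℝ] Space →L[ℝ] ℝ).bilinearComp D D

theorem pullbackInner_apply (D : Plane →L[ℝ] Space) (v w : Plane) :
    pullbackInner D v w = inner ℝ (D v) (D w) := rfl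

theorem contDiff_pullbackInner : ContDiff ℝ ∞ pullbackInner := by
  let B : Space →L[ℝ] Space →L[ℝ] ℝ := innerSL ℝ
  have h1 : ContDiff ℝ ∞ fun D : Plane →L[ℝ] Space => B.comp D :=
    contDiff_const.clm_comp contDiff_id
  exact (ContinuousLinearMap.compL ℝ Plane Space ℝ).flip.contDiff.clm_comp h1

/-- In the trivialization at `p` the section is `φ` times the pullback of the inner product by `dψ`
in tangent coordinates, and this pullback is quadratic in the linear map. -/
theorem contMDiff_inducedMetric_smul [IsManifold (𝓡 2) ∞ M] {ψ : M → Space} {φ : M → ℝ}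
    (hψ : ContMDiff (𝓡 2) 𝓘(ℝ, Space) ∞ ψ) (hφ : ContMDiff (𝓡 2) 𝓘(ℝ, ℝ) ∞ φ) :
    ContMDiff (𝓡 2) ((𝓡 2).prod 𝓘(ℝ, Plane →L[ℝ] Plane →L[ℝ] ℝ)) ∞
      (fun p => Bundle.TotalSpace.mk' (Plane →L[ℝ] Plane →L[ℝ] ℝ)
        (E := fun p : M => TangentSpace (𝓡 2) p →L[ℝ] TangentSpace (𝓡 2) p →L[ℝ] ℝ)
        p (φ p • inducedMetric ψ p)) := by
  intro p
  rw [Bundle.contMDiffAt_section]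
  have h1 := (hψ p).mfderiv_const (m := ∞) (by simp)
  have h2 : ContMDiffAt (𝓡 2) 𝓘(ℝ, Plane →L[ℝ] Plane →L[ℝ] ℝ) ∞
      (fun q => φ q • pullbackInner
        (inTangentCoordinates (𝓡 2) 𝓘(ℝ, Space) id ψ (mfderiv (𝓡 2) 𝓘(ℝ, Space) ψ) p q)) p :=
    (hφ p).smul (contDiff_pullbackInner.contDiffAt.comp_contMDiffAt h1)
  refine h2.congr_of_eventuallyEq ?_
  filter_upwards [(chartAt Plane p).open_source.mem_nhds (mem_chart_source Plane p)] with q hq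
  have hq' : q ∈ (trivializationAt Plane (TangentSpace (𝓡 2) (M := M)) p).baseSet := by
    simpa using hq
  have hD (v : Plane) : inTangentCoordinates (𝓡 2) 𝓘(ℝ, Space) id ψ
      (mfderiv (𝓡 2) 𝓘(ℝ, Space) ψ) p q v = (differential ψ q : Plane →L[ℝ] Space)
        ((trivializationAt Plane (TangentSpace (𝓡 2) (M := M)) p).symmL ℝ q v) := by
    unfold inTangentCoordinates
    simp only [ContinuousLinearMap.inCoordinates, ContinuousLinearMap.comp_apply, id]
    rw [TangentBundle.continuousLinearMapAt_model_space]
    rfl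
  have hq'' : q ∈ (trivializationAt (Plane →L[ℝ] ℝ)
      (fun x : M => TangentSpace (𝓡 2) x →L[ℝ] ℝ) p).baseSet := by
    rw [hom_trivializationAt_baseSet]
    exact ⟨hq', Set.mem_univ _⟩
  apply ContinuousLinearMap.ext; intro v
  apply ContinuousLinearMap.ext; intro w
  rw [hom_trivializationAt_apply]
  simp only [ContinuousLinearMap.inCoordinates, ContinuousLinearMap.comp_apply, smul_apply,
    pullbackInner_apply, hD]
  rw [Bundle.Trivialization.continuousLinearMapAt_apply, Bundle.Trivialization.linearMapAt_apply,
    if_pos hq'', hom_trivializationAt_apply]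
  simp only [ContinuousLinearMap.inCoordinates, ContinuousLinearMap.comp_apply, smul_apply]
  rw [Bundle.Trivialization.continuousLinearMapAt_apply, Bundle.Trivialization.linearMapAt_apply]
  exact if_pos (Set.mem_univ q)

theorem isRiemannianMetric_smul_inducedMetric [IsManifold (𝓡 2) ∞ M] {ψ : M → Space} {φ : M → ℝ}
    (hψ : IsSmoothImmersion ψ) (hφ : ContMDiff (𝓡 2) 𝓘(ℝ, ℝ) ∞ φ) (hpos : ∀ p, 0 < φ p) :
    IsRiemannianMetric (fun p => φ p • inducedMetric ψ p) := by
  refine ⟨⟨fun p => φ p • inducedMetric ψ p, fun p v w => ?_, fun p v hv => ?_, fun p => ?_,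
    contMDiff_inducedMetric_smul hψ.1 hφ⟩, fun p => rfl⟩
  · change φ p * inducedMetric ψ p v w = φ p * inducedMetric ψ p w v
    rw [inducedMetric_apply, inducedMetric_apply, real_inner_comm]
  · change 0 < φ p * inducedMetric ψ p v v
    rw [inducedMetric_apply]
    refine mul_pos (hpos p) (real_inner_self_pos.2 fun h0 => hv (hψ.2 p (h0.trans ?_)))
    exact (map_zero _).symm
  · exact isVonNBounded_of_pos (hψ.2 p) (hpos p)

theorem metricInChart_smul (φ : M → ℝ) (g : FormField M) (e : OpenPartialHomeomorph M Plane)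
    (x : Plane) : metricInChart (fun p => φ p • g p) e x =
      φ (e.symm x) • metricInChart g e x := rfl

variable [IsManifold (𝓡 2) ∞ M] {ψ η : M → Space}

theorem gaussCurvature_inducedMetric (hψ : IsSmoothImmersion ψ) (hη : IsUnitNormal ψ η)
    (hbi : IsBiconservative ψ) (hf : ∀ p, 0 < meanCurvature ψ η p)
    (hgrad : ∀ p v, IsGradientAt (inducedMetric ψ) (meanCurvature ψ η) p v → v ≠ 0) (p : M) :
    gaussCurvature (inducedMetric ψ) p = -(3 / 4) * meanCurvature ψ η p ^ 2 := by
  have he : chartAt Plane p ∈ atlas Plane M := chart_mem_atlas Plane p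
  have hp : p ∈ (chartAt Plane p).source := mem_chart_source Plane p
  have hpatch := isBiconservativePatch he hψ hη hbi hf hgrad
  have hx := (chartAt Plane p).map_source hp
  have hev : metricInChart (inducedMetric ψ) (chartAt Plane p) =ᶠ[𝓝 (chartAt Plane p p)]
      firstForm fun y => ψ ((chartAt Plane p).symm y) := by
    filter_upwards [(chartAt Plane p).open_target.mem_nhds hx] with z hz
    exact metricInChart_inducedMetric he hz hψ
  rw [gaussCurvature, gaussCoord_congr hev, hpatch.gaussCoord_eq hx,
    ← meanCurvature_eq he hx hψ hη, (chartAt Plane p).left_inv hp]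

theorem gaussCurvature_rpow_smul (hψ : IsSmoothImmersion ψ) (hη : IsUnitNormal ψ η)
    (hbi : IsBiconservative ψ) (hf : ∀ p, 0 < meanCurvature ψ η p)
    (hgrad : ∀ p v, IsGradientAt (inducedMetric ψ) (meanCurvature ψ η) p v → v ≠ 0)
    {c : ℝ} (hc : 0 < c) (s : ℝ) (p : M) :
    c * meanCurvature ψ η p ^ s *
        gaussCurvature (fun q => (c * meanCurvature ψ η q ^ s) • inducedMetric ψ q) p =
      (s / 2 - 3 / 4) * meanCurvature ψ η p ^ 2 := by
  have he : chartAt Plane p ∈ atlas Plane M := chart_mem_atlas Plane p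
  have hp : p ∈ (chartAt Plane p).source := mem_chart_source Plane p
  have hpatch := isBiconservativePatch he hψ hη hbi hf hgrad
  have hx := (chartAt Plane p).map_source hp
  set X : Plane → Space := fun y => ψ ((chartAt Plane p).symm y) with hX
  set N : Plane → Space := fun y => η ((chartAt Plane p).symm y) with hN
  have hev : metricInChart (fun q => (c * meanCurvature ψ η q ^ s) • inducedMetric ψ q)
      (chartAt Plane p) =ᶠ[𝓝 (chartAt Plane p p)]
      fun y => (c * meanCoord X N y ^ s) • firstForm X y := by
    filter_upwards [(chartAt Plane p).open_target.mem_nhds hx] with z hz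
    rw [metricInChart_smul (fun q => c * meanCurvature ψ η q ^ s),
      metricInChart_inducedMetric he hz hψ, meanCurvature_eq he hz hψ hη]
  have h1 := hpatch.gaussCoord_rpow_smul hx hc s
  rw [gaussCurvature, gaussCoord_congr hev]
  rwa [hX, hN, ← meanCurvature_eq he hx hψ hη, (chartAt Plane p).left_inv hp] at h1

/-- The real exponent `1` is kept so that the result has the shape `c f^s`. -/
theorem rpow_half_mul_sq {f : ℝ} (hf : 0 < f) :
    (3 / 4 * f ^ 2) ^ (1 / 2 : ℝ) = (3 / 4 : ℝ) ^ (1 / 2 : ℝ) * f ^ (1 : ℝ) := by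
  rw [Real.mul_rpow (by norm_num) (by positivity), ← Real.rpow_natCast, ← Real.rpow_mul hf.le]
  norm_num

end Surface

end Biconservative

end

/-! ### The Ricci condition -/

theorem mainTheorem5 {M : Type*} [TopologicalSpace M] [ChartedSpace Biconservative.Plane M]
    [IsManifold (𝓡 2) ∞ M] [T2Space M] [SecondCountableTopology M] [ConnectedSpace M]
    (ψ η : M → Biconservative.Space)
    (hψ : Biconservative.IsSmoothImmersion ψ)
    (hη : Biconservative.IsUnitNormal ψ η)
    (hbi : Biconservative.IsBiconservative ψ)
    (hf : ∀ p, 0 < Biconservative.meanCurvature ψ η p)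
    (hgrad : ∀ p v, Biconservative.IsGradientAt (Biconservative.inducedMetric ψ)
      (Biconservative.meanCurvature ψ η) p v → v ≠ 0) :
    (∀ p, Biconservative.gaussCurvature (Biconservative.inducedMetric ψ) p < 0) ∧
    Biconservative.IsRicciSurface 0 (fun p =>
      ((-Biconservative.gaussCurvature (Biconservative.inducedMetric ψ) p) ^ (1 / 2 : ℝ)) •
        Biconservative.inducedMetric ψ p) := by
  have hK := Biconservative.gaussCurvature_inducedMetric hψ hη hbi hf hgrad
  set f := Biconservative.meanCurvature ψ η with hfdef
  set g := Biconservative.inducedMetric ψ with hg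
  refine ⟨fun p => by rw [hK]; nlinarith [pow_pos (hf p) 2], ?_⟩
  set c : ℝ := (3 / 4 : ℝ) ^ (1 / 2 : ℝ) with hc
  have hc0 : 0 < c := by positivity
  have hmetric : (fun p => ((-Biconservative.gaussCurvature g p) ^ (1 / 2 : ℝ)) • g p) =
      fun p => (c * f p ^ (1 : ℝ)) • g p := by
    funext p
    rw [hK, ← Biconservative.rpow_half_mul_sq (hf p)]
    congr 2
    ring
  rw [hmetric]
  -- The case `s = 1` reads `c f K̃ = -f²/4`.
  have hK1 (p : M) : 0 - Biconservative.gaussCurvature (fun p => (c * f p ^ (1 : ℝ)) • g p) p =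
      (4 * c)⁻¹ * f p := by
    have h1 := Biconservative.gaussCurvature_rpow_smul hψ hη hbi hf hgrad hc0 1 p
    have hfp := (hf p).ne'
    rw [← hfdef, ← hg] at h1
    generalize Biconservative.gaussCurvature (fun p => (c * f p ^ (1 : ℝ)) • g p) p = K at *
    rw [Real.rpow_one] at h1
    have h2 : c * K = -(1 / 4) * f p := mul_left_cancel₀ hfp (by linear_combination h1)
    field_simp
    linear_combination -4 * h2
  refine ⟨?_, fun p => ?_, fun p => ?_⟩
  · refine Biconservative.isRiemannianMetric_smul_inducedMetric hψ ?_ fun p => ?_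
    · simp only [Real.rpow_one]
      exact contMDiff_const.mul (Biconservative.contMDiff_meanCurvature hψ hη)
    · have := hf p
      positivity
  · rw [hK1]
    have := hf p
    positivity
  -- By `hK1` the new factor is a constant times `f^{1/2}`, so the metric is a constant multiple of
  -- `f^{3/2} g`, the exponent at which `s/2 - 3/4` vanishes.
  · have hflat : (fun q => ((0 - Biconservative.gaussCurvature
        (fun p => (c * f p ^ (1 : ℝ)) • g p) q) ^ (1 / 2 : ℝ)) • (c * f q ^ (1 : ℝ)) • g q) =
        fun q => ((4 * c)⁻¹ ^ (1 / 2 : ℝ) * c * f q ^ (3 / 2 : ℝ)) • g q := by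
      funext q
      rw [hK1, Real.mul_rpow (by positivity) (hf q).le, smul_smul,
        show (3 / 2 : ℝ) = 1 / 2 + 1 by norm_num, Real.rpow_add (hf q)]
      congr 1
      ring
    rw [hflat]
    have h1 := Biconservative.gaussCurvature_rpow_smul hψ hη hbi hf hgrad
      (c := (4 * c)⁻¹ ^ (1 / 2 : ℝ) * c) (by positivity) (3 / 2) p
    rw [show (3 / 2 / 2 - 3 / 4 : ℝ) = 0 by norm_num, zero_mul] at h1
    refine (mul_eq_zero.1 h1).resolve_left ?_
    have := hf p
    positivity
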